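/- **Theorem 1.1.** Let $N\ge 3$, $-2<\alpha\le 0$, $p>1$, $\sigma>-1$, and let $C_B(\mathbb R^N)=C(\mathbb R^N)\cap L^\infty(\mathbb R^N)$. Let $\mathbf w\in C_B(\mathbb R^N)$, and let $\zeta$ be given on $(0,\infty)$ either by $\zeta(t)=t^\sigma$ for all $t>0$, or by $\zeta(t)=t^\sigma$ for $0<t<1$ and $\zeta(t)=t^m$ for $t\ge 1$, where $m\in\mathbb R$. For $u_0\in C_B(\mathbb R^N)$ consider the Cauchy problem $$u_t-\Delta u=|x|^\alpha|u|^p+\zeta(t)\,\mathbf w(x)\ \text{ in }(0,\infty)\times\mathbb R^N,\qquad u(0,x)=u_0(x)\ \text{ in }\mathbb R^N.$$ For $0<T\le\infty$, a *$C_B$-mild solution* on $[0,T)\times\mathbb R^N$ is a function $u:[0,T)\times\mathbb R^N\to\mathbb R$ that is continuous, is bounded on $[0,S]\times\mathbb R^N$ for every $S<T$, and satisfies $$u(t)=e^{t\Delta}u_0+\int_0^t e^{(t-\tau)\Delta}\big(|\cdot|^\alpha|u(\tau)|^p\big)\,d\tau+\int_0^t e^{(t-\tau)\Delta}\big(\zeta(\tau)\,\mathbf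 w\big)\,d\tau$$ pointwise on $\mathbb R^N$ for every $t\in[0,T)$, with absolutely convergent integrals. Here $e^{t\Delta}\varphi=G_t\star\varphi$ with $G_t(x)=(4\pi t)^{-N/2}e^{-|x|^2/(4t)}$ for $t>0$, and $e^{0\Delta}\varphi=\varphi$. A $C_B$-mild solution on $[0,T)\times\mathbb R^N$ is *maximal* if it does not extend to a $C_B$-mild solution on $[0,T')\times\mathbb R^N$ with $T'>T$. Then for every $u_0\in C_B(\mathbb R^N)$ there is a unique maximal $C_B$-mild solution $u$, defined on $[0,T^*)\times\mathbb R^N$ for some $T^*\in(0,\infty]$; moreover, every $C_B$-mild solution on some $[0,T)\times\mathbb R^N$ satisfies $T\le T^*$ and coincides with $u$ on $[0,T)\times\mathbb R^N$. If $T^*<\infty$, then $\lim_{t\to T^*,\,t<T^*}\|u(t)\|_{L^\infty(\mathbb R^N)}=\infty$. If $u_0\ge 0$ and $\mathbf w\ge 0$, then $u\ge 0$ on $[0,T^*)\times\mathbb R^N$. -/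

import Mathlib

open MeasureTheory Filter Topology Set
open scoped BoundedContinuousFunction

noncomputable section

namespace InhomogeneousHeat

/-- The heat kernel `G_t(x) = (4πt)^{-N/2} exp(-|x|²/(4t))` on `ℝ^N`, for `t > 0`. -/
def heatKernel (N : ℕ) (t : ℝ) (x : EuclideanSpace ℝ (Fin N)) : ℝ :=
  (4 * Real.pi * t) ^ (-(N : ℝ) / 2) * Real.exp (-‖x‖ ^ 2 / (4 * t))

/-- The heat semigroup: `e^{tΔ} φ = G_t ⋆ φ` for `t > 0`, and the identity at `t = 0`. -/
def heatSemigroup {N : ℕ} (t : ℝ) (φ : EuclideanSpace ℝ (Fin N) → ℝ)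
    (x : EuclideanSpace ℝ (Fin N)) : ℝ :=
  if t = 0 then φ x else ∫ y, heatKernel N t (x - y) * φ y

/-- The Duhamel integral `∫_0^t e^{(t-τ)Δ} F(τ) dτ`, evaluated at `x`. -/
def duhamel {N : ℕ} (F : ℝ → EuclideanSpace ℝ (Fin N) → ℝ) (t : ℝ)
    (x : EuclideanSpace ℝ (Fin N)) : ℝ :=
  ∫ τ in (0 : ℝ)..t, heatSemigroup (t - τ) (F τ) x

/-- All the integrals in `duhamel F t x` converge absolutely. -/
def DuhamelConverges {N : ℕ} (F : ℝ → EuclideanSpace ℝ (Fin N) → ℝ) (t : ℝ)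
    (x : EuclideanSpace ℝ (Fin N)) : Prop :=
  (∀ τ ∈ Ioo (0 : ℝ) t, Integrable (fun y => heatKernel N (t - τ) (x - y) * F τ y)) ∧
    IntervalIntegrable (fun τ => heatSemigroup (t - τ) (F τ) x) volume 0 t

/-- The admissible time factors: `ζ(t) = t^σ` for all `t > 0`, or `ζ(t) = t^σ` for `0 < t < 1`
and `ζ(t) = t^m` for `t ≥ 1`, with some `m ∈ ℝ`. The value at `t = 0` is irrelevant. -/
def IsForcingProfile (σ : ℝ) (ζ : ℝ → ℝ) : Prop :=
  (∀ t : ℝ, 0 < t → ζ t = t ^ σ) ∨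
    ∃ m : ℝ, (∀ t : ℝ, 0 < t → t < 1 → ζ t = t ^ σ) ∧ ∀ t : ℝ, 1 ≤ t → ζ t = t ^ m

/-- `u` is a `C_B`-mild solution on `[0,T) × ℝ^N`, `T ∈ (0,∞]`, of
`u_t - Δu = |x|^α |u|^p + ζ(t) w(x)`, `u(0) = u₀`: it is continuous on `[0,T) × ℝ^N`, bounded on
`[0,S] × ℝ^N` for every `S < T`, and satisfies the integral equation there.
Only the values `u t x` with `0 ≤ t < T` matter. -/
structure IsMildSolution {N : ℕ} (α p : ℝ) (ζ : ℝ → ℝ) (w u₀ : EuclideanSpace ℝ (Fin N) → ℝ)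
    (T : EReal) (u : ℝ → EuclideanSpace ℝ (Fin N) → ℝ) : Prop where
  pos : 0 < T
  continuousOn : ContinuousOn (fun q : ℝ × EuclideanSpace ℝ (Fin N) => u q.1 q.2)
    {q | 0 ≤ q.1 ∧ (q.1 : EReal) < T}
  bounded : ∀ S : ℝ, (S : EReal) < T → ∃ M : ℝ, ∀ t ∈ Icc 0 S, ∀ x, |u t x| ≤ M
  converges : ∀ t : ℝ, 0 ≤ t → (t : EReal) < T → ∀ x,
    DuhamelConverges (fun τ y => ‖y‖ ^ α * |u τ y| ^ p) t x ∧
      DuhamelConverges (fun τ y => ζ τ * w y) t x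
  integral_eq : ∀ t : ℝ, 0 ≤ t → (t : EReal) < T → ∀ x,
    u t x = heatSemigroup t u₀ x + duhamel (fun τ y => ‖y‖ ^ α * |u τ y| ^ p) t x
      + duhamel (fun τ y => ζ τ * w y) t x

/-- A `C_B`-mild solution on `[0,T)` is maximal if no `C_B`-mild solution on a strictly longer
interval extends it. -/
def IsMaximalMildSolution {N : ℕ} (α p : ℝ) (ζ : ℝ → ℝ)
    (w u₀ : EuclideanSpace ℝ (Fin N) → ℝ)
    (T : EReal) (u : ℝ → EuclideanSpace ℝ (Fin N) → ℝ) : Prop :=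
  IsMildSolution α p ζ w u₀ T u ∧
    ∀ (T' : EReal) (v : ℝ → EuclideanSpace ℝ (Fin N) → ℝ), T < T' →
      IsMildSolution α p ζ w u₀ T' v →
        ¬ ∀ t : ℝ, 0 ≤ t → (t : EReal) < T → v t = u t

end InhomogeneousHeat

end

namespace InhomogeneousHeat

/-! Against the singular weight the heat kernel loses only a power of time: ∫ G_s(x-y)|y|^α dy ≤ C
s^{α/2}, uniformly in x (`integral_heatKernel_mul_norm_rpow_le`). Since α > -2, this is integrable
at s = 0, so the weighted Duhamel operator acts on bounded continuous functions with norm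
O(δ^{α/2+1}) on [0,δ]. The condition σ > -1 makes the forcing integrable in time. As u ↦ |u|^p is
Lipschitz on balls, Banach's fixed point theorem gives a solution on [0,δ], where, for fixed w, δ
depends only on bounds for the initial datum and for ∫_0^1 |ζ| (`exists_solvesOn`). The same
smallness, used on consecutive short intervals, gives uniqueness (`SolvesOn.unique`).

By the semigroup property the integral equation can be restarted at any time S
(`IsSource.duhamel_add`), so local solutions can be concatenated (`SolvesOn.glue`). The restarted
forcing ζ(S+·) has an L¹ bound on [0,1] that is uniform for S ≤ R, so the continuation time depends
only on R and on a bound for u(S) (`exists_extend`).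

T* is the supremum of all existence times, and uniqueness patches all solutions into a single u. If
‖u(t)‖ stayed below some M at times t accumulating at a finite T*, uniform continuation from such a
t close to T* would pass beyond T*; hence the norm has limit ∞, not merely an infinite upper limit.
Nonnegativity is read off the integral equation term by term. -/

/-- The physical space `ℝ^N`. -/
abbrev Space (N : ℕ) := EuclideanSpace ℝ (Fin N)

/-! ### Gaussian kernel identities and the weighted smoothing estimate -/

section Kernel

variable {N : ℕ}

lemma heatKernel_nonneg {t : ℝ} (ht : 0 < t) (x : Space N) : 0 ≤ heatKernel N t x := by
  unfold heatKernel; positivity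

lemma heatKernel_pos {t : ℝ} (ht : 0 < t) (x : Space N) : 0 < heatKernel N t x := by
  unfold heatKernel; positivity

lemma continuous_heatKernel (t : ℝ) : Continuous (heatKernel N t) := by
  unfold heatKernel; fun_prop

lemma measurable_heatKernel : Measurable (fun q : ℝ × Space N => heatKernel N q.1 q.2) := by
  unfold heatKernel; fun_prop

lemma heatKernel_le {t : ℝ} (ht : 0 < t) (x : Space N) :
    heatKernel N t x ≤ (4 * Real.pi * t) ^ (-(N : ℝ) / 2) := by
  unfold heatKernel
  refine mul_le_of_le_one_right (by positivity) (Real.exp_le_one_iff.2 ?_)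
  rw [neg_div]
  have : 0 ≤ ‖x‖ ^ 2 / (4 * t) := by positivity
  linarith

lemma integral_exp_neg_mul_sq_norm_sub {b : ℝ} (hb : 0 < b) (c : Space N) :
    ∫ y : Space N, Real.exp (-b * ‖y - c‖ ^ 2) = (Real.pi / b) ^ ((N : ℝ) / 2) := by
  rw [integral_sub_right_eq_self (fun y : Space N => Real.exp (-b * ‖y‖ ^ 2)) c,
    GaussianFourier.integral_rexp_neg_mul_sq_norm hb]
  simp

lemma integral_heatKernel {t : ℝ} (ht : 0 < t) : ∫ y : Space N, heatKernel N t y = 1 := by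
  have h := integral_exp_neg_mul_sq_norm_sub (N := N) (b := 1 / (4 * t)) (by positivity) 0
  unfold heatKernel
  rw [integral_const_mul]
  have h2 : (fun y : Space N => Real.exp (-‖y‖ ^ 2 / (4 * t)))
      = fun y => Real.exp (-(1 / (4 * t)) * ‖y - 0‖ ^ 2) := by
    ext y; congr 1; rw [sub_zero]; ring
  rw [h2, h, show Real.pi / (1 / (4 * t)) = 4 * Real.pi * t by field_simp,
    ← Real.rpow_add (by positivity)]
  simp [neg_div]

lemma integrable_heatKernel {t : ℝ} (ht : 0 < t) : Integrable (heatKernel N t) := by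
  -- The integral of a non-integrable function is 0 by convention, so the value 1 already forces
  -- integrability.
  by_contra h
  have := integral_heatKernel (N := N) ht
  rw [integral_undef h] at this
  exact zero_ne_one this

lemma integrable_heatKernel_sub {t : ℝ} (ht : 0 < t) (x : Space N) :
    Integrable (fun y => heatKernel N t (x - y)) :=
  (integrable_heatKernel ht).comp_sub_left x

lemma integral_heatKernel_sub {t : ℝ} (ht : 0 < t) (x : Space N) :
    ∫ y, heatKernel N t (x - y) = 1 := by
  rw [integral_sub_left_eq_self (fun y => heatKernel N t y), integral_heatKernel ht]

lemma heatKernel_sqrt_smul {t : ℝ} (ht : 0 < t) (z : Space N) :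
    heatKernel N t (√t • z) = t ^ (-(N : ℝ) / 2) * heatKernel N 1 z := by
  unfold heatKernel
  rw [Real.mul_rpow (by positivity) ht.le, norm_smul, mul_pow, Real.norm_eq_abs, sq_abs,
    Real.sq_sqrt ht.le, show -(t * ‖z‖ ^ 2) / (4 * t) = -‖z‖ ^ 2 / (4 * 1) by field_simp]
  ring_nf

/-- Self-similar form of the heat semigroup, valid down to `t = 0`. -/
lemma heatSemigroup_eq_integral_sqrt_smul {t : ℝ} (ht : 0 ≤ t) (φ : Space N → ℝ) (x : Space N) :
    heatSemigroup t φ x = ∫ z, heatKernel N 1 z * φ (x - √t • z) := by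
  rcases ht.eq_or_lt with rfl | ht
  · simp [heatSemigroup, integral_mul_const, integral_heatKernel]
  rw [heatSemigroup, if_neg ht.ne']
  have h := Measure.integral_comp_smul (volume : Measure (Space N))
    (fun y => heatKernel N t y * φ (x - y)) (√t)
  have h1 : ∫ y, heatKernel N t (x - y) * φ y = ∫ y, heatKernel N t y * φ (x - y) := by
    rw [← integral_sub_left_eq_self (fun y => heatKernel N t y * φ (x - y)) volume x]
    simp
  simp only [heatKernel_sqrt_smul ht, mul_assoc, integral_const_mul, finrank_euclideanSpace,
    Fintype.card_fin, smul_eq_mul] at h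
  have h2 : |(√t ^ N)⁻¹| = t ^ (-(N : ℝ) / 2) := by
    rw [abs_of_pos (by positivity), Real.sqrt_eq_rpow, ← Real.rpow_natCast, ← Real.rpow_mul ht.le,
      ← Real.rpow_neg ht.le]
    ring_nf
  rw [h2] at h
  rw [h1]
  exact (mul_left_cancel₀ (by positivity) h).symm

/-- The Chapman-Kolmogorov identity. -/
lemma integral_heatKernel_mul_heatKernel {t s : ℝ} (ht : 0 < t) (hs : 0 < s) (x z : Space N) :
    ∫ y, heatKernel N t (x - y) * heatKernel N s (y - z) = heatKernel N (t + s) (x - z) := by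
  -- Completing the square in y: the product is a Gaussian centred at z + (s/(t+s))(x - z), times a
  -- factor free of y.
  have key : ∀ y : Space N, heatKernel N t (x - y) * heatKernel N s (y - z)
      = ((4 * Real.pi * t) ^ (-(N : ℝ) / 2) * (4 * Real.pi * s) ^ (-(N : ℝ) / 2)
        * Real.exp (-‖x - z‖ ^ 2 / (4 * (t + s))))
        * Real.exp (-((t + s) / (4 * t * s)) * ‖y - (z + (s / (t + s)) • (x - z))‖ ^ 2) := by
    intro y
    have e1 : ‖x - y‖ ^ 2 = ‖x - z‖ ^ 2 - 2 * inner ℝ (x - z) (y - z) + ‖y - z‖ ^ 2 := by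
      rw [← norm_sub_sq_real]; congr 2; abel
    have e2 : ‖y - (z + (s / (t + s)) • (x - z))‖ ^ 2
        = ‖y - z‖ ^ 2 - 2 * ((s / (t + s)) * inner ℝ (x - z) (y - z))
          + (s / (t + s)) ^ 2 * ‖x - z‖ ^ 2 := by
      rw [← sub_sub, norm_sub_sq_real, inner_smul_right, norm_smul, mul_pow, Real.norm_eq_abs,
        sq_abs, real_inner_comm]
    unfold heatKernel
    rw [mul_mul_mul_comm, ← Real.exp_add, mul_assoc _ (Real.exp _), ← Real.exp_add, e1, e2]
    congr 2
    field_simp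
    ring
  simp_rw [key]
  rw [integral_const_mul, integral_exp_neg_mul_sq_norm_sub (by positivity)]
  unfold heatKernel
  rw [mul_right_comm]
  congr 1
  rw [neg_div, Real.rpow_neg (by positivity), Real.rpow_neg (by positivity),
    Real.rpow_neg (by positivity), ← mul_inv, ← Real.mul_rpow (by positivity) (by positivity),
    ← Real.inv_rpow (by positivity), ← Real.mul_rpow (by positivity) (by positivity),
    ← Real.inv_rpow (by positivity)]
  congr 1
  field_simp

lemma integrable_norm_rpow_ball {β : ℝ} (hβ : -(N : ℝ) < β) (hβ₀ : β ≤ 0) (r : ℝ) :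
    IntegrableOn (fun y : Space N => ‖y‖ ^ β) (Metric.ball 0 r) := by
  have hN : 1 ≤ N := by
    have : (0 : ℝ) < N := by linarith
    exact_mod_cast this
  refine integrableOn_ball_of_norm_le_rpow (C := 1) (α := -β) (by simpa) (by simp; linarith)
    (ae_of_all _ fun y => ?_) (Measurable.aestronglyMeasurable (by fun_prop))
  simp [abs_of_nonneg (Real.rpow_nonneg (norm_nonneg y) β)]

/-- The constant in the smoothing estimate for the weight `|x|^β`. -/
noncomputable def weightConst (N : ℕ) (β : ℝ) : ℝ :=
  1 + (4 * Real.pi) ^ (-(N : ℝ) / 2) * ∫ y in Metric.ball (0 : Space N) 1, ‖y‖ ^ β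

lemma weightConst_pos (N : ℕ) (β : ℝ) : 0 < weightConst N β := by
  have : 0 ≤ ∫ y in Metric.ball (0 : Space N) 1, ‖y‖ ^ β :=
    integral_nonneg fun y => by positivity
  unfold weightConst; positivity

lemma setIntegral_ball_norm_rpow (β : ℝ) {r : ℝ} (hr : 0 < r) :
    ∫ y in Metric.ball (0 : Space N) r, ‖y‖ ^ β
      = r ^ ((N : ℝ) + β) * ∫ y in Metric.ball (0 : Space N) 1, ‖y‖ ^ β := by
  have h := Measure.setIntegral_comp_smul_of_pos (volume : Measure (Space N))
    (fun y => ‖y‖ ^ β) (Metric.ball 0 1) hr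
  simp only [norm_smul, Real.norm_eq_abs, abs_of_pos hr,
    Real.mul_rpow hr.le (norm_nonneg _), integral_const_mul, finrank_euclideanSpace,
    Fintype.card_fin, smul_eq_mul, smul_unitBall_of_pos hr] at h
  rw [Real.rpow_add hr, Real.rpow_natCast, mul_assoc, h, ← mul_assoc,
    mul_inv_cancel₀ (by positivity), one_mul]


/-- Split at the parabolic radius √s. Outside the ball, β ≤ 0 gives |y|^β ≤ s^{β/2}; inside it, the
kernel is at most its maximum. -/
lemma heatKernel_mul_norm_rpow_le {β s : ℝ} (hβ₀ : β ≤ 0) (hs : 0 < s) (x y : Space N) :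
    heatKernel N s (x - y) * ‖y‖ ^ β ≤ s ^ (β / 2) * heatKernel N s (x - y)
      + (4 * Real.pi * s) ^ (-(N : ℝ) / 2)
        * (Metric.ball (0 : Space N) √s).indicator (fun y => ‖y‖ ^ β) y := by
  have h0 := heatKernel_nonneg hs (x - y)
  by_cases hy : y ∈ Metric.ball (0 : Space N) √s
  · rw [indicator_of_mem hy]
    have := mul_le_mul_of_nonneg_right (heatKernel_le hs (x - y))
      (Real.rpow_nonneg (norm_nonneg y) β)
    have : 0 ≤ s ^ (β / 2) * heatKernel N s (x - y) := by positivity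
    linarith
  · rw [indicator_of_notMem hy, mul_zero, add_zero, mul_comm]
    refine mul_le_mul_of_nonneg_right ?_ h0
    have hy' : √s ≤ ‖y‖ := by simpa using hy
    calc ‖y‖ ^ β ≤ √s ^ β := Real.rpow_le_rpow_of_nonpos (by positivity) hy' hβ₀
      _ = s ^ (β / 2) := by
        rw [Real.sqrt_eq_rpow, ← Real.rpow_mul hs.le]; ring_nf

lemma integrable_heatKernel_mul_norm_rpow {β s : ℝ} (hβ : -(N : ℝ) < β) (hβ₀ : β ≤ 0)
    (hs : 0 < s) (x : Space N) :
    Integrable (fun y => heatKernel N s (x - y) * ‖y‖ ^ β) := by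
  have h1 : Integrable (fun y : Space N => s ^ (β / 2) * heatKernel N s (x - y)
      + (4 * Real.pi * s) ^ (-(N : ℝ) / 2)
        * (Metric.ball (0 : Space N) √s).indicator (fun y => ‖y‖ ^ β) y) :=
    ((integrable_heatKernel_sub hs x).const_mul _).add
      (((integrable_norm_rpow_ball hβ hβ₀ _).integrable_indicator
        Metric.isOpen_ball.measurableSet).const_mul _)
  refine h1.mono' ?_ (ae_of_all _ fun y => ?_)
  · have := (continuous_heatKernel (N := N) s).measurable
    exact Measurable.aestronglyMeasurable (by fun_prop)
  · rw [Real.norm_of_nonneg (mul_nonneg (heatKernel_nonneg hs _) (by positivity))]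
    exact heatKernel_mul_norm_rpow_le hβ₀ hs x y

/-- By scaling, the ball of radius √s contributes s^{(N+β)/2}, and the factor s^{-N/2} from the
kernel turns this into s^{β/2}, the same power as the outer part. -/
lemma integral_heatKernel_mul_norm_rpow_le {β s : ℝ} (hβ : -(N : ℝ) < β) (hβ₀ : β ≤ 0)
    (hs : 0 < s) (x : Space N) :
    ∫ y, heatKernel N s (x - y) * ‖y‖ ^ β ≤ weightConst N β * s ^ (β / 2) := by
  have i1 := (integrable_heatKernel_sub hs x).const_mul (s ^ (β / 2))
  have i2 := ((integrable_norm_rpow_ball hβ hβ₀ √s).integrable_indicator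
        Metric.isOpen_ball.measurableSet).const_mul ((4 * Real.pi * s) ^ (-(N : ℝ) / 2))
  refine (integral_mono (integrable_heatKernel_mul_norm_rpow hβ hβ₀ hs x) (i1.add i2)
    (heatKernel_mul_norm_rpow_le hβ₀ hs x)).trans_eq ?_
  simp only [Pi.add_apply]
  rw [integral_add i1 i2, integral_const_mul, integral_const_mul, integral_heatKernel_sub hs,
    integral_indicator Metric.isOpen_ball.measurableSet,
    setIntegral_ball_norm_rpow β (by positivity), Real.sqrt_eq_rpow, ← Real.rpow_mul hs.le,
    Real.mul_rpow (by positivity) hs.le, weightConst]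
  have : s ^ (β / 2) = s ^ (-(N : ℝ) / 2) * s ^ (1 / 2 * ((N : ℝ) + β)) := by
    rw [← Real.rpow_add hs]; ring_nf
  rw [this]; ring

/-- On the unit ball around `x₀`, heat kernels are dominated by one centred at `x₀`. -/
lemma heatKernel_sub_le {s : ℝ} (hs : 0 < s) {x x₀ : Space N} (hx : ‖x - x₀‖ ≤ 1) (y : Space N) :
    heatKernel N s (x - y) ≤ (4 * Real.pi * s) ^ (-(N : ℝ) / 2) * Real.exp (1 / (4 * s))
      * (4 * Real.pi * (2 * s)) ^ ((N : ℝ) / 2) * heatKernel N (2 * s) (x₀ - y) := by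
  unfold heatKernel
  -- This inequality is what doubles the time in the dominating kernel; its additive 2 becomes the
  -- factor exp(1/(4s)).
  have h1 : ‖x₀ - y‖ ^ 2 ≤ 2 * ‖x - y‖ ^ 2 + 2 := by
    have h : ‖x₀ - y‖ ≤ ‖x - y‖ + 1 := by
      calc ‖x₀ - y‖ = ‖(x - y) - (x - x₀)‖ := by congr 1; abel
        _ ≤ ‖x - y‖ + ‖x - x₀‖ := norm_sub_le _ _
        _ ≤ _ := by linarith
    nlinarith [sq_nonneg (‖x - y‖ - 1), norm_nonneg (x₀ - y)]
  have h2 : Real.exp (-‖x - y‖ ^ 2 / (4 * s))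
      ≤ Real.exp (1 / (4 * s)) * Real.exp (-‖x₀ - y‖ ^ 2 / (4 * (2 * s))) := by
    rw [← Real.exp_add]
    refine Real.exp_le_exp.2 ?_
    rw [div_add_div _ _ (by positivity) (by positivity), div_le_div_iff₀ (by positivity)
      (by positivity)]
    have : 0 < s ^ 2 := by positivity
    nlinarith
  have h3 : (4 * Real.pi * (2 * s)) ^ ((N : ℝ) / 2) * (4 * Real.pi * (2 * s)) ^ (-(N : ℝ) / 2)
      = 1 := by
    rw [← Real.rpow_add (by positivity)]; simp [neg_div]
  calc _ ≤ (4 * Real.pi * s) ^ (-(N : ℝ) / 2)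
        * (Real.exp (1 / (4 * s)) * Real.exp (-‖x₀ - y‖ ^ 2 / (4 * (2 * s)))) := by gcongr
    _ = (4 * Real.pi * s) ^ (-(N : ℝ) / 2) * Real.exp (1 / (4 * s))
        * ((4 * Real.pi * (2 * s)) ^ ((N : ℝ) / 2) * (4 * Real.pi * (2 * s)) ^ (-(N : ℝ) / 2))
        * Real.exp (-‖x₀ - y‖ ^ 2 / (4 * (2 * s))) := by rw [h3]; ring
    _ = _ := by ring

end Kernel

/-! ### Duhamel integrals of sources bounded by a(τ)|y|^β -/

section Source

variable {N : ℕ} {β : ℝ}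

lemma integrable_heatKernel_mul {A s : ℝ} {φ : Space N → ℝ} (hβ : -(N : ℝ) < β) (hβ₀ : β ≤ 0)
    (hs : 0 < s) (hφ : Measurable φ) (hA : ∀ y, |φ y| ≤ A * ‖y‖ ^ β) (x : Space N) :
    Integrable (fun y => heatKernel N s (x - y) * φ y) := by
  refine ((integrable_heatKernel_mul_norm_rpow hβ hβ₀ hs x).const_mul A).mono' ?_
    (ae_of_all _ fun y => ?_)
  · have := (continuous_heatKernel (N := N) s).measurable
    exact Measurable.aestronglyMeasurable (by fun_prop)
  · have h0 := heatKernel_nonneg hs (x - y)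
    rw [norm_mul, Real.norm_of_nonneg h0, Real.norm_eq_abs]
    calc _ ≤ heatKernel N s (x - y) * (A * ‖y‖ ^ β) := mul_le_mul_of_nonneg_left (hA y) h0
      _ = _ := by ring

lemma abs_integral_heatKernel_mul_le {A s : ℝ} {φ : Space N → ℝ} (hβ : -(N : ℝ) < β)
    (hβ₀ : β ≤ 0) (hs : 0 < s) (hA₀ : 0 ≤ A) (hA : ∀ y, |φ y| ≤ A * ‖y‖ ^ β) (x : Space N) :
    |∫ y, heatKernel N s (x - y) * φ y| ≤ A * (weightConst N β * s ^ (β / 2)) := by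
  have h := norm_integral_le_of_norm_le
    ((integrable_heatKernel_mul_norm_rpow hβ hβ₀ hs x).const_mul A)
    (f := fun y => heatKernel N s (x - y) * φ y) (ae_of_all _ fun y => ?_)
  · rw [integral_const_mul] at h
    exact h.trans (mul_le_mul_of_nonneg_left (integral_heatKernel_mul_norm_rpow_le hβ hβ₀ hs x) hA₀)
  · have h0 := heatKernel_nonneg hs (x - y)
    rw [norm_mul, Real.norm_of_nonneg h0, Real.norm_eq_abs]
    calc _ ≤ heatKernel N s (x - y) * (A * ‖y‖ ^ β) := mul_le_mul_of_nonneg_left (hA y) h0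
      _ = _ := by ring

/-- The semigroup property of the heat flow, for weighted bounded functions. -/
lemma integral_heatKernel_mul_integral {A s t : ℝ} {φ : Space N → ℝ} (hβ : -(N : ℝ) < β)
    (hβ₀ : β ≤ 0) (ht : 0 < t) (hs : 0 < s) (hφ : Measurable φ)
    (hA : ∀ y, |φ y| ≤ A * ‖y‖ ^ β) (x : Space N) :
    ∫ y, heatKernel N t (x - y) * ∫ z, heatKernel N s (y - z) * φ z
      = ∫ z, heatKernel N (t + s) (x - z) * φ z := by
  have hm1 := (continuous_heatKernel (N := N) t).measurable
  have hm2 := (continuous_heatKernel (N := N) s).measurable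
  -- Fubini is justified by integrating in y first: Chapman-Kolmogorov then leaves the kernel at
  -- time t + s against |φ|.
  have hint : Integrable (Function.uncurry fun y z : Space N =>
      heatKernel N t (x - y) * (heatKernel N s (y - z) * φ z)) (volume.prod volume) := by
    rw [integrable_prod_iff' (Measurable.aestronglyMeasurable (by fun_prop))]
    constructor
    · refine ae_of_all _ fun z => ?_
      have : Integrable (fun y => heatKernel N t (x - y) * heatKernel N s (y - z)) := by
        by_contra h
        have h1 := integral_heatKernel_mul_heatKernel ht hs x z
        rw [integral_undef h] at h1
        exact (heatKernel_pos (add_pos ht hs) (x - z)).ne h1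
      simpa [Function.uncurry, mul_assoc] using this.mul_const (φ z)
    · have h2 := (integrable_heatKernel_mul hβ hβ₀ (add_pos ht hs) hφ hA x).norm
      refine h2.congr (ae_of_all _ fun z => ?_)
      simp only [Function.uncurry, norm_mul, Real.norm_of_nonneg (heatKernel_nonneg ht _),
        Real.norm_of_nonneg (heatKernel_nonneg hs _), ← mul_assoc,
        Real.norm_of_nonneg (heatKernel_nonneg (add_pos ht hs) _)]
      rw [integral_mul_const, integral_heatKernel_mul_heatKernel ht hs]
  simp_rw [← integral_const_mul]
  rw [integral_integral_swap hint]
  refine integral_congr_ae (ae_of_all _ fun z => ?_)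
  simp only [← mul_assoc]
  rw [integral_mul_const, integral_heatKernel_mul_heatKernel ht hs]

/-- A jointly measurable source term bounded by `a(τ)|y|^β`. -/
structure IsSource (β : ℝ) (a : ℝ → ℝ) (F : ℝ → Space N → ℝ) : Prop where
  measurable : Measurable (Function.uncurry F)
  nonneg : ∀ τ, 0 ≤ a τ
  bound : ∀ τ y, |F τ y| ≤ a τ * ‖y‖ ^ β

lemma ae_ne_real (t : ℝ) : ∀ᵐ τ : ℝ, τ ≠ t := by
  simp [ae_iff]

/-- The semigroup is the identity rather than a kernel integral only at τ = t, a null set of times.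
-/
lemma duhamel_eq (F : ℝ → Space N → ℝ) (t : ℝ) (x : Space N) :
    duhamel F t x = ∫ τ in (0 : ℝ)..t, ∫ y, heatKernel N (t - τ) (x - y) * F τ y := by
  refine intervalIntegral.integral_congr_ae ?_
  filter_upwards [ae_ne_real t] with τ hτ _
  rw [heatSemigroup, if_neg (sub_ne_zero.2 hτ.symm)]

lemma duhamel_congr {F F' : ℝ → Space N → ℝ} {t : ℝ} (ht : 0 ≤ t)
    (h : ∀ τ ∈ Ioo 0 t, F τ = F' τ) (x : Space N) : duhamel F t x = duhamel F' t x := by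
  refine intervalIntegral.integral_congr_ae ?_
  filter_upwards [ae_ne_real t] with τ hτ h2
  rw [uIoc_of_le ht] at h2
  rw [h τ ⟨h2.1, lt_of_le_of_ne h2.2 hτ⟩]

lemma DuhamelConverges.congr {F F' : ℝ → Space N → ℝ} {t : ℝ} {x : Space N}
    (hF : DuhamelConverges F t x) (ht : 0 ≤ t)
    (h : ∀ τ ∈ Ioo 0 t, F τ = F' τ) : DuhamelConverges F' t x := by
  refine ⟨fun τ hτ => by rw [← h τ hτ]; exact hF.1 τ hτ, hF.2.congr_ae ?_⟩
  rw [uIoc_of_le ht, EventuallyEq, ae_restrict_iff' measurableSet_Ioc]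
  filter_upwards [ae_ne_real t] with τ hτ h2
  rw [h τ ⟨h2.1, lt_of_le_of_ne h2.2 hτ⟩]

namespace IsSource

variable {a : ℝ → ℝ} {F : ℝ → Space N → ℝ}

lemma measurable_slice (hF : IsSource β a F) (τ : ℝ) : Measurable (F τ) :=
  hF.measurable.comp measurable_prodMk_left

lemma measurable_integral (hF : IsSource β a F) (t : ℝ) :
    Measurable (fun q : ℝ × Space N => ∫ y, heatKernel N (t - q.1) (q.2 - y) * F q.1 y) := by
  have h1 := measurable_heatKernel (N := N)
  have h2 := hF.measurable
  have h : Measurable (fun q : (ℝ × Space N) × Space N =>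
      heatKernel N (t - q.1.1) (q.1.2 - q.2) * F q.1.1 q.2) := by
    refine Measurable.mul ?_ ?_
    · exact h1.comp (f := fun q : (ℝ × Space N) × Space N => (t - q.1.1, q.1.2 - q.2))
        (by fun_prop)
    · exact h2.comp (f := fun q : (ℝ × Space N) × Space N => (q.1.1, q.2)) (by fun_prop)
  exact h.stronglyMeasurable.integral_prod_right'.measurable

lemma measurable_integral_left (hF : IsSource β a F) (t : ℝ) (x : Space N) :
    Measurable (fun τ => ∫ y, heatKernel N (t - τ) (x - y) * F τ y) :=
  (hF.measurable_integral t).comp (measurable_id.prodMk measurable_const)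

lemma intervalIntegrable (hF : IsSource β a F) (hβ : -(N : ℝ) < β) (hβ₀ : β ≤ 0) {t b c : ℝ}
    (hb : b ≤ c) (hc : c ≤ t)
    (ha : IntervalIntegrable (fun τ => a τ * (t - τ) ^ (β / 2)) volume b c) (x : Space N) :
    IntervalIntegrable (fun τ => ∫ y, heatKernel N (t - τ) (x - y) * F τ y) volume b c := by
  refine (ha.const_mul (weightConst N β)).mono_fun'
    (hF.measurable_integral_left t x).aestronglyMeasurable ?_
  rw [uIoc_of_le hb, EventuallyLE, ae_restrict_iff' measurableSet_Ioc]
  filter_upwards [ae_ne_real c] with τ hτ h2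
  have h3 : τ < t := (lt_of_le_of_ne h2.2 hτ).trans_le hc
  refine (abs_integral_heatKernel_mul_le hβ hβ₀ (sub_pos.2 h3) (hF.nonneg τ) (hF.bound τ)
    x).trans_eq ?_
  ring

lemma converges (hF : IsSource β a F) (hβ : -(N : ℝ) < β) (hβ₀ : β ≤ 0) {t : ℝ} (ht : 0 ≤ t)
    (ha : IntervalIntegrable (fun τ => a τ * (t - τ) ^ (β / 2)) volume 0 t) (x : Space N) :
    DuhamelConverges F t x := by
  refine ⟨fun τ hτ => integrable_heatKernel_mul hβ hβ₀ (sub_pos.2 hτ.2) (hF.measurable_slice τ)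
    (hF.bound τ) x, (hF.intervalIntegrable hβ hβ₀ ht le_rfl ha x).congr_ae ?_⟩
  rw [uIoc_of_le ht, EventuallyEq, ae_restrict_iff' measurableSet_Ioc]
  filter_upwards [ae_ne_real t] with τ hτ _
  rw [heatSemigroup, if_neg (sub_ne_zero.2 hτ.symm)]

lemma abs_duhamel_le (hF : IsSource β a F) (hβ : -(N : ℝ) < β) (hβ₀ : β ≤ 0) {t : ℝ} (ht : 0 ≤ t)
    (ha : IntervalIntegrable (fun τ => a τ * (t - τ) ^ (β / 2)) volume 0 t) (x : Space N) :
    |duhamel F t x| ≤ weightConst N β * ∫ τ in (0 : ℝ)..t, a τ * (t - τ) ^ (β / 2) := by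
  rw [← Real.norm_eq_abs, duhamel_eq, ← intervalIntegral.integral_const_mul]
  refine intervalIntegral.norm_integral_le_of_norm_le ht ?_ (ha.const_mul _)
  filter_upwards [ae_ne_real t] with τ hτ h2
  refine (abs_integral_heatKernel_mul_le hβ hβ₀ (sub_pos.2 (lt_of_le_of_ne h2.2 hτ))
    (hF.nonneg τ) (hF.bound τ) x).trans_eq ?_
  ring

/-- Restarting the Duhamel integral at a later time `S`. -/
lemma duhamel_add (hF : IsSource β a F) (hβ : -(N : ℝ) < β) (hβ₀ : β ≤ 0) {S t : ℝ} (hS : 0 ≤ S)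
    (ht : 0 ≤ t) (ha : ∀ r, 0 ≤ r →
      IntervalIntegrable (fun τ => a τ * (r - τ) ^ (β / 2)) volume 0 r) (x : Space N) :
    duhamel F (S + t) x = heatSemigroup t (duhamel F S) x + duhamel (fun τ => F (S + τ)) t x := by
  rcases ht.eq_or_lt with rfl | ht
  · simp [heatSemigroup, duhamel]
  have hI := hF.intervalIntegrable hβ hβ₀ (by linarith) le_rfl (ha (S + t) (by linarith)) x
  have hsub : uIcc 0 S ⊆ uIcc 0 (S + t) := by
    rw [uIcc_of_le hS, uIcc_of_le (by linarith)]; exact Icc_subset_Icc_right (by linarith)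
  have hsub' : uIcc S (S + t) ⊆ uIcc 0 (S + t) := by
    rw [uIcc_of_le (by linarith), uIcc_of_le (by linarith)]; exact Icc_subset_Icc_left hS
  rw [duhamel_eq, duhamel_eq, heatSemigroup, if_neg ht.ne',
    ← intervalIntegral.integral_add_adjacent_intervals (hI.mono_set hsub) (hI.mono_set hsub')]
  congr 1
  -- The past [0,S]: exchange the space and time integrals, with majorant G_t(x-y) a(τ)(S-τ)^{β/2}
  -- up to a constant, then apply the semigroup property at each τ.
  · simp_rw [duhamel_eq, intervalIntegral.integral_of_le hS, integral_Ioc_eq_integral_Ioo]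
    have haS : Integrable (fun τ => a τ * (S - τ) ^ (β / 2)) (volume.restrict (Ioo 0 S)) :=
      ((intervalIntegrable_iff_integrableOn_Ioc_of_le hS).1 (ha S hS)).mono_set
        Ioo_subset_Ioc_self
    have hmaj := (haS.const_mul (weightConst N β)).mul_prod (integrable_heatKernel_sub ht x)
    have hmeas := hF.measurable_integral S
    have hker := (continuous_heatKernel (N := N) t).measurable
    have hint : Integrable (Function.uncurry fun (y : Space N) τ => heatKernel N t (x - y) *
        ∫ z, heatKernel N (S - τ) (y - z) * F τ z) (volume.prod (volume.restrict (Ioo 0 S))) := by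
      refine hmaj.swap.mono' (Measurable.aestronglyMeasurable ?_) ?_
      · exact (hker.comp (f := fun q : Space N × ℝ => x - q.1) (by fun_prop)).mul
          (hmeas.comp measurable_swap)
      · have := Measure.quasiMeasurePreserving_snd (μ := (volume : Measure (Space N)))
          (ν := volume.restrict (Ioo 0 S)) |>.ae (ae_restrict_mem measurableSet_Ioo)
        filter_upwards [this] with q hq
        have h0 := heatKernel_nonneg ht (x - q.1)
        simp only [Function.uncurry, norm_mul, Real.norm_of_nonneg h0, Function.comp, Prod.swap]
        rw [mul_comm]
        refine mul_le_mul_of_nonneg_right ?_ h0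
        refine (abs_integral_heatKernel_mul_le hβ hβ₀ (sub_pos.2 hq.2) (hF.nonneg _)
          (hF.bound _) _).trans_eq ?_
        ring
    have hmul : ∀ y : Space N, heatKernel N t (x - y) *
        ∫ τ in Ioo 0 S, ∫ z, heatKernel N (S - τ) (y - z) * F τ z = ∫ τ in Ioo 0 S,
          heatKernel N t (x - y) * ∫ z, heatKernel N (S - τ) (y - z) * F τ z :=
      fun y => (integral_const_mul _ _).symm
    rw [integral_congr_ae (ae_of_all _ hmul), integral_integral_swap hint]
    refine setIntegral_congr_fun measurableSet_Ioo fun τ hτ => ?_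
    rw [integral_heatKernel_mul_integral hβ hβ₀ ht (sub_pos.2 hτ.2) (hF.measurable_slice τ)
      (hF.bound τ)]
    ring_nf
  · have := intervalIntegral.integral_comp_add_left (a := 0) (b := t)
      (fun τ => ∫ y, heatKernel N (S + t - τ) (x - y) * F τ y) S
    rw [add_zero] at this
    rw [← this]
    simp only [add_sub_add_left_eq_sub]

end IsSource

end Source

/-! ### The heat flow on bounded continuous functions -/

section Flow

variable {N : ℕ}

lemma integrable_heatKernel_mul_bcf (φ : Space N →ᵇ ℝ) (t : ℝ) (x : Space N) :
    Integrable (fun z => heatKernel N 1 z * φ (x - √t • z)) := by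
  refine ((integrable_heatKernel one_pos).mul_const ‖φ‖).mono' ?_ (ae_of_all _ fun z => ?_)
  · have := continuous_heatKernel (N := N) 1
    exact Continuous.aestronglyMeasurable (by fun_prop)
  · rw [norm_mul, Real.norm_of_nonneg (heatKernel_nonneg one_pos z)]
    exact mul_le_mul_of_nonneg_left (φ.norm_coe_le_norm _) (heatKernel_nonneg one_pos z)

/-- In self-similar variables the kernel does not depend on time, so dominated convergence works
through t = 0. Negative times cause no trouble because `√` vanishes there. -/
lemma continuous_heatFlow (φ : Space N →ᵇ ℝ) :
    Continuous (fun q : ℝ × Space N => ∫ z, heatKernel N 1 z * φ (q.2 - √q.1 • z)) := by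
  have hk := continuous_heatKernel (N := N) 1
  refine continuous_of_dominated (bound := fun z => heatKernel N 1 z * ‖φ‖)
    (fun q => (integrable_heatKernel_mul_bcf φ q.1 q.2).aestronglyMeasurable)
    (fun q => ae_of_all _ fun z => ?_) ((integrable_heatKernel one_pos).mul_const _)
    (ae_of_all _ fun z => by fun_prop)
  rw [norm_mul, Real.norm_of_nonneg (heatKernel_nonneg one_pos z)]
  exact mul_le_mul_of_nonneg_left (φ.norm_coe_le_norm _) (heatKernel_nonneg one_pos z)

lemma continuousOn_heatSemigroup (φ : Space N →ᵇ ℝ) :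
    ContinuousOn (fun q : ℝ × Space N => heatSemigroup q.1 φ q.2) {q | 0 ≤ q.1} :=
  (continuous_heatFlow φ).continuousOn.congr
    fun q hq => heatSemigroup_eq_integral_sqrt_smul hq φ q.2

lemma abs_heatSemigroup_le {t : ℝ} (ht : 0 ≤ t) (φ : Space N →ᵇ ℝ) (x : Space N) :
    |heatSemigroup t φ x| ≤ ‖φ‖ := by
  rw [heatSemigroup_eq_integral_sqrt_smul ht, ← Real.norm_eq_abs]
  refine (norm_integral_le_of_norm_le ((integrable_heatKernel one_pos).mul_const ‖φ‖)
    (ae_of_all _ fun z => ?_)).trans_eq ?_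
  · rw [norm_mul, Real.norm_of_nonneg (heatKernel_nonneg one_pos z)]
    exact mul_le_mul_of_nonneg_left (φ.norm_coe_le_norm _) (heatKernel_nonneg one_pos z)
  · rw [integral_mul_const, integral_heatKernel one_pos, one_mul]

lemma heatSemigroup_add_bcf {t : ℝ} (ht : 0 ≤ t) (φ ψ : Space N →ᵇ ℝ) (x : Space N) :
    heatSemigroup t (fun y => φ y + ψ y) x = heatSemigroup t φ x + heatSemigroup t ψ x := by
  simp only [heatSemigroup_eq_integral_sqrt_smul ht, mul_add]
  exact integral_add (integrable_heatKernel_mul_bcf φ t x) (integrable_heatKernel_mul_bcf ψ t x)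

lemma heatSemigroup_nonneg {t : ℝ} (ht : 0 ≤ t) {φ : Space N → ℝ} (hφ : ∀ x, 0 ≤ φ x)
    (x : Space N) : 0 ≤ heatSemigroup t φ x := by
  rw [heatSemigroup_eq_integral_sqrt_smul ht]
  exact integral_nonneg fun z => mul_nonneg (heatKernel_nonneg one_pos z) (hφ _)

lemma duhamel_nonneg {F : ℝ → Space N → ℝ} {t : ℝ} (ht : 0 ≤ t)
    (hF : ∀ τ, 0 < τ → ∀ x, 0 ≤ F τ x) (x : Space N) : 0 ≤ duhamel F t x := by
  refine intervalIntegral.integral_nonneg_of_ae_restrict ht ?_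
  rw [EventuallyLE, ae_restrict_iff' measurableSet_Icc]
  filter_upwards [ae_ne_real 0] with τ h0 hτ
  exact heatSemigroup_nonneg (sub_nonneg.2 hτ.2) (hF τ (lt_of_le_of_ne hτ.1 h0.symm)) x

lemma heatSemigroup_heatSemigroup (hN : 0 < N) {t s : ℝ} (ht : 0 ≤ t) (hs : 0 ≤ s)
    (φ : Space N →ᵇ ℝ) (x : Space N) :
    heatSemigroup t (heatSemigroup s φ) x = heatSemigroup (s + t) φ x := by
  rcases ht.eq_or_lt with rfl | ht
  · simp [heatSemigroup]
  rcases hs.eq_or_lt with rfl | hs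
  · rw [zero_add]; congr 1; ext y; simp [heatSemigroup]
  simp only [heatSemigroup, if_neg ht.ne', if_neg hs.ne', if_neg (add_pos hs ht).ne']
  -- Bounded functions are the case β = 0, where the condition -N < β says that N is positive.
  rw [integral_heatKernel_mul_integral (A := ‖φ‖) (β := 0) (by simpa) le_rfl ht hs
    φ.continuous.measurable (fun y => by simpa using φ.norm_coe_le_norm y), add_comm]

end Flow

/-! ### Bounds and continuity for the weighted Duhamel term -/

section Weighted

variable {N : ℕ} {α : ℝ}

/-- The source `|x|^α q(t,x)`. -/
noncomputable abbrev weighted (α : ℝ) (q : ℝ → Space N → ℝ) : ℝ → Space N → ℝ := fun τ y => ‖y‖ ^ α * q τ y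

lemma isSource_weighted (α : ℝ) (q : ℝ × Space N →ᵇ ℝ) :
    IsSource α (fun _ => ‖q‖) (weighted α fun τ y => q (τ, y)) where
  measurable := by
    have := q.continuous.measurable
    simp only [Function.uncurry_def]
    fun_prop
  nonneg _ := norm_nonneg _
  bound τ y := by
    rw [abs_mul, abs_of_nonneg (Real.rpow_nonneg (norm_nonneg y) α), mul_comm]
    exact mul_le_mul_of_nonneg_right (q.norm_coe_le_norm _) (by positivity)

lemma intervalIntegrable_const_mul_sub_rpow (hα : -2 < α) (A r b c : ℝ) :
    IntervalIntegrable (fun τ : ℝ => A * (r - τ) ^ (α / 2)) volume b c := by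
  have h := (intervalIntegral.intervalIntegrable_rpow' (r := α / 2) (a := r - b) (b := r - c)
    (by linarith)).comp_sub_left r
  simpa using h.const_mul A

/-- Integrating the smoothing estimate in time leaves a positive power of t, the source of all
smallness on short intervals. -/
lemma abs_duhamel_weighted_le (hN : 2 ≤ N) (hα : -2 < α) (hα₀ : α ≤ 0) (q : ℝ × Space N →ᵇ ℝ)
    {t : ℝ} (ht : 0 ≤ t) (x : Space N) :
    |duhamel (weighted α fun τ y => q (τ, y)) t x|
      ≤ weightConst N α / (α / 2 + 1) * t ^ (α / 2 + 1) * ‖q‖ := by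
  have hN' : (2 : ℝ) ≤ N := by exact_mod_cast hN
  refine ((isSource_weighted α q).abs_duhamel_le (by linarith) hα₀ ht
    (intervalIntegrable_const_mul_sub_rpow hα _ _ _ _) x).trans_eq ?_
  rw [intervalIntegral.integral_const_mul,
    intervalIntegral.integral_comp_sub_left (fun τ => τ ^ (α / 2)) t, sub_self, sub_zero,
    integral_rpow (Or.inl (by linarith)), Real.zero_rpow (by linarith)]
  ring

/-- At fixed s > 0, the kernels centred within distance 1 of the base point share one integrable
majorant, a kernel at time 2s. -/
lemma continuousAt_integral_heatKernel_weighted (hN : 2 ≤ N) (hα : -2 < α) (hα₀ : α ≤ 0)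
    (q : ℝ × Space N →ᵇ ℝ) {s : ℝ} (hs : 0 < s) (p₀ : ℝ × Space N) :
    ContinuousAt (fun p : ℝ × Space N =>
      ∫ y, heatKernel N s (p.2 - y) * (‖y‖ ^ α * q (p.1 - s, y))) p₀ := by
  have hN' : (2 : ℝ) ≤ N := by exact_mod_cast hN
  have hk := continuous_heatKernel (N := N) s
  set K := (4 * Real.pi * s) ^ (-(N : ℝ) / 2) * Real.exp (1 / (4 * s))
      * (4 * Real.pi * (2 * s)) ^ ((N : ℝ) / 2) with hK
  have hq := q.continuous
  refine continuousAt_of_dominated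
    (bound := fun y => K * ‖q‖ * (heatKernel N (2 * s) (p₀.2 - y) * ‖y‖ ^ α)) ?_ ?_ ?_ ?_
  · refine Eventually.of_forall fun p => Measurable.aestronglyMeasurable ?_
    have := hk.measurable
    have := hq.measurable
    fun_prop
  · have : ∀ᶠ p in 𝓝 p₀, ‖p.2 - p₀.2‖ < 1 := by
      have hc : ContinuousAt (fun p : ℝ × Space N => ‖p.2 - p₀.2‖) p₀ := by fun_prop
      exact hc.eventually_lt continuousAt_const (by simp)
    filter_upwards [this] with p hp
    refine ae_of_all _ fun y => ?_
    have h0 := heatKernel_nonneg hs (p.2 - y)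
    rw [norm_mul, norm_mul, Real.norm_of_nonneg h0,
      Real.norm_of_nonneg (Real.rpow_nonneg (norm_nonneg y) α)]
    calc _ ≤ (K * heatKernel N (2 * s) (p₀.2 - y)) * (‖y‖ ^ α * ‖q‖) := by
          refine mul_le_mul (heatKernel_sub_le hs hp.le y) ?_ (by positivity) ?_
          · exact mul_le_mul_of_nonneg_left (q.norm_coe_le_norm _) (by positivity)
          · have := heatKernel_nonneg (N := N) (t := 2 * s) (by positivity) (p₀.2 - y)
            positivity
      _ = _ := by ring
  · exact (integrable_heatKernel_mul_norm_rpow (by linarith) hα₀ (by positivity) _).const_mul _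
  · refine ae_of_all _ fun y => Continuous.continuousAt ?_
    fun_prop

/-- The substitution s = t - τ pins the kernel singularity at s = 0, so that dominated convergence
can be used while t varies. -/
lemma duhamel_eq_integral_indicator (F : ℝ → Space N → ℝ) {t : ℝ} (ht : 0 ≤ t) (x : Space N) :
    duhamel F t x
      = ∫ s, (Ioo 0 t).indicator (fun s => ∫ y, heatKernel N s (x - y) * F (t - s) y) s := by
  have h := intervalIntegral.integral_comp_sub_left (a := 0) (b := t)
    (fun s => ∫ y, heatKernel N s (x - y) * F (t - s) y) t
  simp only [sub_sub_cancel, sub_self, sub_zero] at h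
  rw [duhamel_eq, h, intervalIntegral.integral_of_le ht, integral_Ioc_eq_integral_Ioo,
    integral_indicator measurableSet_Ioo]

/-- Passing to the limit in an indicator of `(0,t)` away from the moving end point. -/
lemma continuousAt_indicator_Ioo {X : Type*} [TopologicalSpace X] {g : ℝ × X → ℝ → ℝ}
    {s : ℝ} {p₀ : ℝ × X} (hs : s ≠ p₀.1)
    (hg : 0 < s → s < p₀.1 → ContinuousAt (fun p => g p s) p₀) :
    ContinuousAt (fun p => (Ioo 0 p.1).indicator (g p) s) p₀ := by
  by_cases h0 : 0 < s
  · rcases hs.lt_or_gt with h | h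
    · refine (hg h0 h).congr ?_
      have : ∀ᶠ p : ℝ × X in 𝓝 p₀, s < p.1 := continuousAt_fst.eventually (lt_mem_nhds h)
      filter_upwards [this] with p hp
      rw [indicator_of_mem (show s ∈ Ioo 0 p.1 from ⟨h0, hp⟩)]
    · refine (continuousAt_const (y := (0 : ℝ))).congr ?_
      have : ∀ᶠ p : ℝ × X in 𝓝 p₀, p.1 < s := continuousAt_fst.eventually (gt_mem_nhds h)
      filter_upwards [this] with p hp
      exact (indicator_of_notMem (fun hm : s ∈ Ioo 0 p.1 => (hm.2.trans hp).false) _).symm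
  · refine (continuousAt_const (y := (0 : ℝ))).congr (Eventually.of_forall fun p => ?_)
    exact (indicator_of_notMem (fun hm : s ∈ Ioo 0 p.1 => h0 hm.1) _).symm

lemma continuousOn_duhamel_weighted (hN : 2 ≤ N) (hα : -2 < α) (hα₀ : α ≤ 0)
    (q : ℝ × Space N →ᵇ ℝ) :
    ContinuousOn (fun p : ℝ × Space N => duhamel (weighted α fun τ y => q (τ, y)) p.1 p.2)
      {p | 0 ≤ p.1} := by
  have hN' : (2 : ℝ) ≤ N := by exact_mod_cast hN
  have hsrc := isSource_weighted α q
  suffices h : Continuous fun p : ℝ × Space N => ∫ s, (Ioo 0 p.1).indicator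
      (fun s => ∫ y, heatKernel N s (p.2 - y) * (‖y‖ ^ α * q (p.1 - s, y))) s from
    h.continuousOn.congr fun p hp => duhamel_eq_integral_indicator _ hp p.2
  refine continuous_iff_continuousAt.2 fun p₀ => ?_
  refine continuousAt_of_dominated (bound := (Ioo 0 (p₀.1 + 1)).indicator
    fun s => ‖q‖ * (weightConst N α * s ^ (α / 2))) ?_ ?_ ?_ ?_
  · refine Eventually.of_forall fun p => Measurable.aestronglyMeasurable ?_
    refine Measurable.indicator ?_ measurableSet_Ioo
    have := (hsrc.measurable_integral_left p.1 p.2).comp (measurable_const_sub p.1)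
    simpa [Function.comp_def] using this
  · have : ∀ᶠ p : ℝ × Space N in 𝓝 p₀, p.1 < p₀.1 + 1 :=
      continuousAt_fst.eventually (gt_mem_nhds (lt_add_one _))
    filter_upwards [this] with p hp
    refine ae_of_all _ fun s => ?_
    by_cases hs : s ∈ Ioo 0 p.1
    · rw [indicator_of_mem hs, indicator_of_mem (show s ∈ Ioo 0 (p₀.1 + 1) from ⟨hs.1, hs.2.trans hp⟩)]
      exact abs_integral_heatKernel_mul_le (by linarith) hα₀ hs.1 (norm_nonneg _)
        (hsrc.bound (p.1 - s)) p.2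
    · rw [indicator_of_notMem hs, norm_zero]
      refine indicator_nonneg (fun s hs => ?_) s
      have := weightConst_pos N α
      have := hs.1
      positivity
  · rw [integrable_indicator_iff measurableSet_Ioo]
    have := ((intervalIntegral.intervalIntegrable_rpow' (r := α / 2) (a := 0) (b := max 0 (p₀.1 + 1))
      (by linarith)).const_mul (weightConst N α)).const_mul ‖q‖
    refine ((intervalIntegrable_iff_integrableOn_Ioc_of_le (le_max_left _ _)).1 this).mono_set ?_
    exact fun s hs => ⟨hs.1, hs.2.le.trans (le_max_right _ _)⟩
  -- Pointwise continuity may fail only at the endpoint s = p₀.1, where the indicator jumps.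
  · filter_upwards [ae_ne_real p₀.1] with s hs
    exact continuousAt_indicator_Ioo
      (g := fun p s => ∫ y, heatKernel N s (p.2 - y) * (‖y‖ ^ α * q (p.1 - s, y))) hs
      fun h0 _ => continuousAt_integral_heatKernel_weighted hN hα hα₀ q h0 p₀

end Weighted

/-! ### Bounds and continuity for the forcing term -/

section Forcing

variable {N : ℕ} {ζ : ℝ → ℝ}

/-- The source `ζ(t) w(x)`. -/
noncomputable abbrev forcing (ζ : ℝ → ℝ) (w : Space N → ℝ) : ℝ → Space N → ℝ := fun τ y => ζ τ * w y

lemma isSource_forcing (hζ : Measurable ζ) (w : Space N →ᵇ ℝ) :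
    IsSource 0 (fun τ => |ζ τ| * ‖w‖) (forcing ζ w) where
  measurable := by
    have := w.continuous.measurable
    simp only [Function.uncurry_def]
    fun_prop
  nonneg _ := by positivity
  bound τ y := by
    rw [abs_mul, Real.rpow_zero, mul_one]
    exact mul_le_mul_of_nonneg_left (w.norm_coe_le_norm _) (abs_nonneg _)

lemma intervalIntegrable_forcing (hζ : ∀ b c, IntervalIntegrable ζ volume b c) (A r b c : ℝ) :
    IntervalIntegrable (fun τ => |ζ τ| * A * (r - τ) ^ ((0 : ℝ) / 2)) volume b c := by
  simpa using (hζ b c).abs.mul_const A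

lemma abs_duhamel_forcing_le (hN : 0 < N) (hm : Measurable ζ)
    (hζ : ∀ b c, IntervalIntegrable ζ volume b c) (w : Space N →ᵇ ℝ) {t : ℝ} (ht : 0 ≤ t)
    (x : Space N) :
    |duhamel (forcing ζ w) t x| ≤ weightConst N 0 * ((∫ τ in (0 : ℝ)..t, |ζ τ|) * ‖w‖) := by
  refine ((isSource_forcing hm w).abs_duhamel_le (by simpa) le_rfl ht
    (intervalIntegrable_forcing hζ _ _ _ _) x).trans_eq ?_
  simp

/-- As ζ is merely integrable, time is not reversed here: ζ(τ) stays put and the dependence on (t,x)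
is carried by the continuous heat flow of w. -/
lemma continuousOn_duhamel_forcing (hm : Measurable ζ)
    (hζ : ∀ b c, IntervalIntegrable ζ volume b c) (w : Space N →ᵇ ℝ) :
    ContinuousOn (fun p : ℝ × Space N => duhamel (forcing ζ w) p.1 p.2) {p | 0 ≤ p.1} := by
  set P : ℝ × Space N → ℝ := fun q => ∫ z, heatKernel N 1 z * w (q.2 - √q.1 • z) with hP
  have hPc : Continuous P := continuous_heatFlow w
  have hPb : ∀ q, |P q| ≤ ‖w‖ := by
    intro q
    rw [← Real.norm_eq_abs]
    refine (norm_integral_le_of_norm_le ((integrable_heatKernel one_pos).mul_const ‖w‖)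
      (ae_of_all _ fun z => ?_)).trans_eq ?_
    · rw [norm_mul, Real.norm_of_nonneg (heatKernel_nonneg one_pos z)]
      exact mul_le_mul_of_nonneg_left (w.norm_coe_le_norm _) (heatKernel_nonneg one_pos z)
    · rw [integral_mul_const, integral_heatKernel one_pos, one_mul]
  suffices h : Continuous fun p : ℝ × Space N =>
      ∫ τ, (Ioo 0 p.1).indicator (fun τ => ζ τ * P (p.1 - τ, p.2)) τ by
    refine h.continuousOn.congr fun p hp => ?_
    simp only [duhamel]
    rw [integral_indicator measurableSet_Ioo, ← integral_Ioc_eq_integral_Ioo,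
      ← intervalIntegral.integral_of_le hp]
    refine intervalIntegral.integral_congr fun τ hτ => ?_
    rw [uIcc_of_le hp] at hτ
    simp only [heatSemigroup_eq_integral_sqrt_smul (sub_nonneg.2 hτ.2), hP, mul_left_comm _ (ζ τ),
      integral_const_mul]
  refine continuous_iff_continuousAt.2 fun p₀ => ?_
  refine continuousAt_of_dominated (bound := (Ioo 0 (p₀.1 + 1)).indicator
    fun τ => |ζ τ| * ‖w‖) ?_ ?_ ?_ ?_
  · refine Eventually.of_forall fun p => Measurable.aestronglyMeasurable ?_
    refine Measurable.indicator ?_ measurableSet_Ioo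
    have := hPc.measurable
    fun_prop
  · have : ∀ᶠ p : ℝ × Space N in 𝓝 p₀, p.1 < p₀.1 + 1 :=
      continuousAt_fst.eventually (gt_mem_nhds (lt_add_one _))
    filter_upwards [this] with p hp
    refine ae_of_all _ fun s => ?_
    by_cases hs : s ∈ Ioo 0 p.1
    · rw [indicator_of_mem hs, indicator_of_mem (show s ∈ Ioo 0 (p₀.1 + 1) from ⟨hs.1, hs.2.trans hp⟩), norm_mul]
      exact mul_le_mul_of_nonneg_left (hPb _) (abs_nonneg _)
    · rw [indicator_of_notMem hs, norm_zero]
      exact indicator_nonneg (fun s hs => by positivity) s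
  · rw [integrable_indicator_iff measurableSet_Ioo]
    have := (hζ 0 (max 0 (p₀.1 + 1))).abs.mul_const ‖w‖
    refine ((intervalIntegrable_iff_integrableOn_Ioc_of_le (le_max_left _ _)).1 this).mono_set ?_
    exact fun s hs => ⟨hs.1, hs.2.le.trans (le_max_right _ _)⟩
  · filter_upwards [ae_ne_real p₀.1] with s hs
    exact continuousAt_indicator_Ioo (g := fun p τ => ζ τ * P (p.1 - τ, p.2)) hs
      fun _ _ => Continuous.continuousAt (by fun_prop)

end Forcing

/-! ### The nonlinearity as a locally Lipschitz map -/

section AbsPow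

variable {X : Type*} [TopologicalSpace X]

/-- The nonlinearity `|u|^p` as a bounded continuous function. -/
noncomputable def absPow {p : ℝ} (hp : 1 < p) (u : X →ᵇ ℝ) : X →ᵇ ℝ :=
  BoundedContinuousFunction.ofNormedAddCommGroup (fun q => |u q| ^ p)
    (u.continuous.abs.rpow_const fun _ => Or.inr (by linarith)) (‖u‖ ^ p) fun q => by
      rw [Real.norm_of_nonneg (by positivity)]
      exact Real.rpow_le_rpow (abs_nonneg _) (u.norm_coe_le_norm q) (by linarith)

@[simp]
lemma absPow_apply {p : ℝ} (hp : 1 < p) (u : X →ᵇ ℝ) (q : X) : absPow hp u q = |u q| ^ p := rfl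

lemma norm_absPow_le {p B : ℝ} (hp : 1 < p) {u : X →ᵇ ℝ} (hu : ‖u‖ ≤ B) :
    ‖absPow hp u‖ ≤ B ^ p := by
  have hB : 0 ≤ B := (norm_nonneg u).trans hu
  refine (BoundedContinuousFunction.norm_le (by positivity)).2 fun q => ?_
  rw [absPow_apply, Real.norm_of_nonneg (by positivity)]
  exact Real.rpow_le_rpow (abs_nonneg _) ((u.norm_coe_le_norm q).trans hu) (by linarith)

lemma abs_rpow_sub_rpow_le {p B x y : ℝ} (hp : 1 < p) (hx : x ∈ Icc 0 B) (hy : y ∈ Icc 0 B) :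
    |x ^ p - y ^ p| ≤ p * B ^ (p - 1) * |x - y| := by
  have h := (convex_Icc (0 : ℝ) B).norm_image_sub_le_of_norm_hasDerivWithin_le
    (f := fun z => z ^ p) (f' := fun z => p * z ^ (p - 1)) (C := p * B ^ (p - 1))
    (fun z _ => (Real.hasDerivAt_rpow_const (Or.inr hp.le)).hasDerivWithinAt)
    (fun z hz => ?_) hy hx
  · exact h
  · have hz0 := hz.1
    rw [Real.norm_of_nonneg (by positivity)]
    exact mul_le_mul_of_nonneg_left (Real.rpow_le_rpow hz.1 hz.2 (by linarith)) (by linarith)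

lemma norm_absPow_sub_le {p B : ℝ} (hp : 1 < p) {u v : X →ᵇ ℝ} (hu : ‖u‖ ≤ B) (hv : ‖v‖ ≤ B) :
    ‖absPow hp u - absPow hp v‖ ≤ p * B ^ (p - 1) * ‖u - v‖ := by
  have hB : 0 ≤ B := (norm_nonneg u).trans hu
  refine (BoundedContinuousFunction.norm_le (by positivity)).2 fun q => ?_
  refine (abs_rpow_sub_rpow_le hp ⟨abs_nonneg _, (u.norm_coe_le_norm q).trans hu⟩
    ⟨abs_nonneg _, (v.norm_coe_le_norm q).trans hv⟩).trans ?_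
  refine mul_le_mul_of_nonneg_left ?_ (by positivity)
  exact (abs_abs_sub_abs_le_abs_sub _ _).trans ((u - v).norm_coe_le_norm q)

end AbsPow

/-! ### Local existence, uniqueness and continuation -/

section Solutions

variable {N : ℕ} {α p : ℝ} {ζ : ℝ → ℝ} {w g : Space N →ᵇ ℝ}

/-- `u` satisfies the integral equation on the closed time interval `[0,S]`. -/
def SolvesOn (α p : ℝ) (ζ : ℝ → ℝ) (w g : Space N →ᵇ ℝ) (S : ℝ) (u : ℝ × Space N →ᵇ ℝ) : Prop :=
  ∀ t ∈ Icc 0 S, ∀ x, u (t, x) = heatSemigroup t g x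
    + duhamel (weighted α fun τ y => |u (τ, y)| ^ p) t x + duhamel (forcing ζ w) t x

lemma duhamel_weighted_sub (hN : 2 ≤ N) (hα : -2 < α) (hα₀ : α ≤ 0) (q r : ℝ × Space N →ᵇ ℝ)
    {t : ℝ} (ht : 0 ≤ t) (x : Space N) :
    duhamel (weighted α fun τ y => q (τ, y)) t x - duhamel (weighted α fun τ y => r (τ, y)) t x
      = duhamel (weighted α fun τ y => (q - r) (τ, y)) t x := by
  have hN' : (2 : ℝ) ≤ N := by exact_mod_cast hN
  have hq := isSource_weighted α q
  have hr := isSource_weighted α r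
  simp only [duhamel_eq]
  rw [← intervalIntegral.integral_sub
    (hq.intervalIntegrable (by linarith) hα₀ ht le_rfl
      (intervalIntegrable_const_mul_sub_rpow hα _ _ _ _) x)
    (hr.intervalIntegrable (by linarith) hα₀ ht le_rfl
      (intervalIntegrable_const_mul_sub_rpow hα _ _ _ _) x)]
  refine intervalIntegral.integral_congr_ae ?_
  filter_upwards [ae_ne_real t] with τ hτ h2
  rw [uIoc_of_le ht] at h2
  have h3 := sub_pos.2 (lt_of_le_of_ne h2.2 hτ)
  rw [← integral_sub
    (integrable_heatKernel_mul (by linarith) hα₀ h3 (hq.measurable_slice τ) (hq.bound τ) x)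
    (integrable_heatKernel_mul (by linarith) hα₀ h3 (hr.measurable_slice τ) (hr.bound τ) x)]
  refine integral_congr_ae (ae_of_all _ fun y => ?_)
  simp only [BoundedContinuousFunction.coe_sub, Pi.sub_apply]
  ring

/-- The norm of the weighted Duhamel operator on `[0,δ]` can be made small. -/
lemma exists_pos_mul_rpow_mul_le {C e : ℝ} (he : 0 < e) (A : ℝ) :
    ∃ δ, 0 < δ ∧ δ ≤ 1 ∧ C * δ ^ e * A ≤ 1 / 2 := by
  have h : Tendsto (fun δ : ℝ => C * δ ^ e * A) (𝓝[>] 0) (𝓝 (C * 0 ^ e * A)) :=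
    ((((Real.continuous_rpow_const he.le).tendsto 0).mono_left nhdsWithin_le_nhds).const_mul
      C).mul_const A
  rw [Real.zero_rpow he.ne', mul_zero, zero_mul] at h
  have h1 : ∀ᶠ δ : ℝ in 𝓝[>] 0, C * δ ^ e * A < 1 / 2 := h.eventually (gt_mem_nhds (by norm_num))
  have h2 : ∀ᶠ δ : ℝ in 𝓝[>] 0, δ ∈ Ioo (0 : ℝ) 1 := Ioo_mem_nhdsGT one_pos
  obtain ⟨δ, h1, h2⟩ := (h1.and h2).exists
  exact ⟨δ, h2.1, h2.2.le, h1.le⟩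

lemma abs_duhamel_weighted_le_of_le (hN : 2 ≤ N) (hα : -2 < α) (hα₀ : α ≤ 0)
    (q : ℝ × Space N →ᵇ ℝ) {t δ : ℝ} (ht : 0 ≤ t) (htδ : t ≤ δ) (x : Space N) :
    |duhamel (weighted α fun τ y => q (τ, y)) t x|
      ≤ weightConst N α / (α / 2 + 1) * δ ^ (α / 2 + 1) * ‖q‖ := by
  have he : 0 < α / 2 + 1 := by linarith
  have := weightConst_pos N α
  refine (abs_duhamel_weighted_le hN hα hα₀ q ht x).trans ?_
  gcongr

/-- Local existence, on a time interval controlled by the sizes of the data. -/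
lemma exists_solvesOn (hN : 2 ≤ N) (hα : -2 < α) (hα₀ : α ≤ 0) (hp : 1 < p) (w : Space N →ᵇ ℝ)
    (M I : ℝ) :
    ∃ δ, 0 < δ ∧ ∀ ζ : ℝ → ℝ, Measurable ζ → (∀ b c, IntervalIntegrable ζ volume b c) →
      ∫ τ in (0 : ℝ)..1, |ζ τ| ≤ I → ∀ g : Space N →ᵇ ℝ, ‖g‖ ≤ M →
        ∃ v, SolvesOn α p ζ w g δ v := by
  -- The radius covers the linear flow and the forcing up to time 1, with 1 to spare for the
  -- nonlinear term.
  set B := |M| + weightConst N 0 * (|I| * ‖w‖) + 1 with hBdef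
  have hc0 := weightConst_pos N 0
  have hB : 0 < B := by positivity
  have he : 0 < α / 2 + 1 := by linarith
  set C := weightConst N α / (α / 2 + 1) with hC
  have hC0 : 0 < C := div_pos (weightConst_pos N α) he
  -- One smallness condition on a sum of nonnegative terms gives both invariance of the ball (B^p)
  -- and contraction (pB^{p-1}).
  obtain ⟨δ, hδ, hδ1, hsmall⟩ := exists_pos_mul_rpow_mul_le (C := C) he (B ^ p + p * B ^ (p - 1))
  have hsmall1 : C * δ ^ (α / 2 + 1) * B ^ p ≤ 1 := by
    have : 0 ≤ C * δ ^ (α / 2 + 1) * (p * B ^ (p - 1)) := by positivity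
    linarith
  have hsmall2 : C * δ ^ (α / 2 + 1) * (p * B ^ (p - 1)) ≤ 1 / 2 := by
    have : 0 ≤ C * δ ^ (α / 2 + 1) * B ^ p := by positivity
    linarith
  refine ⟨δ, hδ, fun ζ hm hζ hI g hg => ?_⟩
  -- Clamping time to [0,δ] lets the fixed point problem live in the complete space of bounded
  -- continuous functions on all of ℝ × ℝ^N.
  set cl : ℝ → ℝ := fun t => max 0 (min t δ) with hcl
  have hcl0 : ∀ t, 0 ≤ cl t := fun t => le_max_left _ _
  have hclδ : ∀ t, cl t ≤ δ := fun t => max_le hδ.le (min_le_right _ _)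
  have hclc : Continuous cl := by fun_prop
  have hforce : ∀ t x, |duhamel (forcing ζ w) (cl t) x| ≤ weightConst N 0 * (|I| * ‖w‖) := by
    intro t x
    refine (abs_duhamel_forcing_le (by omega) hm hζ w (hcl0 t) x).trans ?_
    have h1 : ∫ τ in (0 : ℝ)..cl t, |ζ τ| ≤ ∫ τ in (0 : ℝ)..1, |ζ τ| :=
      intervalIntegral.integral_mono_interval le_rfl (hcl0 t) ((hclδ t).trans hδ1)
        (ae_of_all _ fun τ => abs_nonneg _) (hζ 0 1).abs
    have h2 := h1.trans (hI.trans (le_abs_self I))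
    gcongr
  have hbound : ∀ (v : ℝ × Space N →ᵇ ℝ) (q : ℝ × Space N),
      |heatSemigroup (cl q.1) g q.2 + duhamel (weighted α fun τ y => |v (τ, y)| ^ p) (cl q.1) q.2
        + duhamel (forcing ζ w) (cl q.1) q.2|
        ≤ |M| + C * δ ^ (α / 2 + 1) * ‖absPow hp v‖ + weightConst N 0 * (|I| * ‖w‖) := by
    intro v q
    refine (abs_add_le _ _).trans (add_le_add ((abs_add_le _ _).trans (add_le_add ?_ ?_))
      (hforce q.1 q.2))
    · exact (abs_heatSemigroup_le (hcl0 _) g _).trans (hg.trans (le_abs_self M))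
    · exact abs_duhamel_weighted_le_of_le hN hα hα₀ (absPow hp v) (hcl0 _) (hclδ _) _
  have hex : ∀ v : ℝ × Space N →ᵇ ℝ, ∃ Φ : ℝ × Space N →ᵇ ℝ, ∀ q, Φ q =
      heatSemigroup (cl q.1) g q.2 + duhamel (weighted α fun τ y => |v (τ, y)| ^ p) (cl q.1) q.2
        + duhamel (forcing ζ w) (cl q.1) q.2 := by
    intro v
    refine ⟨BoundedContinuousFunction.ofNormedAddCommGroup _ ?_ _ (hbound v), fun q => rfl⟩
    have hk : Continuous fun q : ℝ × Space N => (cl q.1, q.2) := by fun_prop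
    have hk' : ∀ q : ℝ × Space N, (cl q.1, q.2) ∈ {r : ℝ × Space N | 0 ≤ r.1} := fun q => hcl0 q.1
    exact (((continuousOn_heatSemigroup g).comp_continuous hk hk').add
      ((continuousOn_duhamel_weighted hN hα hα₀ (absPow hp v)).comp_continuous hk hk')).add
      ((continuousOn_duhamel_forcing hm hζ w).comp_continuous hk hk')
  choose Φ hΦ using hex
  have hmaps : MapsTo Φ (Metric.closedBall 0 B) (Metric.closedBall 0 B) := by
    intro v hv
    rw [mem_closedBall_zero_iff] at hv ⊢
    refine (BoundedContinuousFunction.norm_le hB.le).2 fun q => ?_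
    rw [hΦ, Real.norm_eq_abs]
    refine (hbound v q).trans ?_
    have : C * δ ^ (α / 2 + 1) * ‖absPow hp v‖ ≤ C * δ ^ (α / 2 + 1) * B ^ p :=
      mul_le_mul_of_nonneg_left (norm_absPow_le hp hv) (by positivity)
    linarith
  have hcontr : ContractingWith (1 / 2) (hmaps.restrict Φ _ _) := by
    refine ⟨by rw [← NNReal.coe_lt_coe]; norm_num, LipschitzWith.of_dist_le_mul fun u v => ?_⟩
    have hu := mem_closedBall_zero_iff.1 u.2
    have hv := mem_closedBall_zero_iff.1 v.2
    rw [Subtype.dist_eq, Subtype.dist_eq, MapsTo.val_restrict_apply, MapsTo.val_restrict_apply,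
      dist_eq_norm, dist_eq_norm]
    refine (BoundedContinuousFunction.norm_le (by positivity)).2 fun q => ?_
    rw [BoundedContinuousFunction.coe_sub, Pi.sub_apply, hΦ, hΦ, add_sub_add_right_eq_sub,
      add_sub_add_left_eq_sub]
    have h1 := duhamel_weighted_sub hN hα hα₀ (absPow hp u.1) (absPow hp v.1) (hcl0 q.1) q.2
    simp only [absPow_apply] at h1
    rw [h1, Real.norm_eq_abs]
    refine (abs_duhamel_weighted_le_of_le hN hα hα₀ _ (hcl0 q.1) (hclδ q.1) q.2).trans ?_
    calc C * δ ^ (α / 2 + 1) * ‖absPow hp u.1 - absPow hp v.1‖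
        ≤ C * δ ^ (α / 2 + 1) * (p * B ^ (p - 1) * ‖u.1 - v.1‖) :=
          mul_le_mul_of_nonneg_left (norm_absPow_sub_le hp hu hv) (by positivity)
      _ = C * δ ^ (α / 2 + 1) * (p * B ^ (p - 1)) * ‖u.1 - v.1‖ := by ring
      _ ≤ 1 / 2 * ‖u.1 - v.1‖ := mul_le_mul_of_nonneg_right hsmall2 (norm_nonneg _)
      _ = _ := by norm_num
  obtain ⟨v, -, hfix, -⟩ := hcontr.exists_fixedPoint' Metric.isClosed_closedBall.isComplete hmaps
    (x := 0) (by simp [hB.le]) (edist_ne_top _ _)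
  refine ⟨v, fun t ht x => ?_⟩
  have hclt : cl t = t := by simp [hcl, ht.1, ht.2]
  have := hΦ v (t, x)
  rw [hfix.eq] at this
  simpa [hclt] using this

lemma SolvesOn.apply_zero {S : ℝ} {u : ℝ × Space N →ᵇ ℝ} (hu : SolvesOn α p ζ w g S u)
    (hS : 0 ≤ S) (x : Space N) : u (0, x) = g x := by
  rw [hu 0 ⟨le_rfl, hS⟩ x]; simp [heatSemigroup, duhamel]

/-- Restarted at a, the difference of the two solutions is at most half its own supremum on a window
of length at most δ, hence zero. -/
lemma SolvesOn.eq_step (hN : 2 ≤ N) (hα : -2 < α) (hα₀ : α ≤ 0) (hp : 1 < p)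
    {S a b δ B : ℝ} {u v : ℝ × Space N →ᵇ ℝ} (hu : SolvesOn α p ζ w g S u)
    (hv : SolvesOn α p ζ w g S v) (huB : ‖u‖ ≤ B) (hvB : ‖v‖ ≤ B)
    (hδ : weightConst N α / (α / 2 + 1) * δ ^ (α / 2 + 1) * (p * B ^ (p - 1)) ≤ 1 / 2)
    (hδ₀ : 0 < δ) (ha : 0 ≤ a) (hab : a ≤ b) (hbS : b ≤ S) (hba : b - a ≤ δ)
    (h : ∀ t ∈ Icc 0 a, ∀ x, u (t, x) = v (t, x)) :
    ∀ t ∈ Icc 0 b, ∀ x, u (t, x) = v (t, x) := by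
  have hN' : (2 : ℝ) ≤ N := by exact_mod_cast hN
  have he : 0 < α / 2 + 1 := by linarith
  have hC := weightConst_pos N α
  set cl : ℝ → ℝ := fun t => a + max 0 (min t (b - a)) with hcl
  let k : C(ℝ × Space N, ℝ × Space N) := ⟨fun q => (cl q.1, q.2), by fun_prop⟩
  set u' := u.compContinuous k with hu'
  set v' := v.compContinuous k with hv'
  have hu'B : ‖u'‖ ≤ B := (BoundedContinuousFunction.norm_le ((norm_nonneg _).trans huB)).2
    fun q => (u.norm_coe_le_norm _).trans huB
  have hv'B : ‖v'‖ ≤ B := (BoundedContinuousFunction.norm_le ((norm_nonneg _).trans hvB)).2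
    fun q => (v.norm_coe_le_norm _).trans hvB
  have key : ∀ r ∈ Icc 0 (b - a), ∀ x, u (a + r, x) - v (a + r, x)
      = duhamel (weighted α fun τ y => (absPow hp u' - absPow hp v') (τ, y)) r x := by
    intro r hr x
    have hr1 := hr.1
    have hr2 := hr.2
    have h1 := duhamel_weighted_sub hN hα hα₀ (absPow hp u) (absPow hp v)
      (t := a + r) (by linarith) x
    simp only [absPow_apply] at h1
    rw [hu (a + r) ⟨by linarith, by linarith⟩, hv (a + r) ⟨by linarith, by linarith⟩,
      add_sub_add_right_eq_sub, add_sub_add_left_eq_sub, h1,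
      (isSource_weighted α (absPow hp u - absPow hp v)).duhamel_add (by linarith) hα₀ ha hr1
        (fun r _ => intervalIntegrable_const_mul_sub_rpow hα _ _ _ _) x]
    -- The nonlinearities agree before time a, so the restarted difference has zero initial datum.
    have h2 : duhamel (weighted α fun τ y => (absPow hp u - absPow hp v) (τ, y)) a = 0 := by
      ext y
      rw [duhamel_congr (F' := 0) ha]
      · simp [duhamel, heatSemigroup]
      · intro τ hτ
        ext z
        simp [h τ ⟨hτ.1.le, hτ.2.le⟩ z]
    rw [h2]
    have h3 : heatSemigroup r (0 : Space N → ℝ) x = 0 := by simp [heatSemigroup]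
    rw [h3, zero_add]
    refine duhamel_congr hr1 (fun τ hτ => ?_) x
    ext y
    have : cl τ = a + τ := by
      simp [hcl, hτ.1.le, hτ.2.le.trans hr2]
    simp [hu', hv', k, this]
  have hle : ‖u' - v'‖ ≤ 1 / 2 * ‖u' - v'‖ := by
    refine (BoundedContinuousFunction.norm_le (by positivity)).2 fun q => ?_
    have hr : max 0 (min q.1 (b - a)) ∈ Icc 0 (b - a) :=
      ⟨le_max_left _ _, max_le (by linarith) (min_le_right _ _)⟩
    have := key _ hr q.2
    have h4 : (u' - v') q = u (cl q.1, q.2) - v (cl q.1, q.2) := rfl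
    rw [h4, this, Real.norm_eq_abs]
    refine (abs_duhamel_weighted_le_of_le hN hα hα₀ _ hr.1 (hr.2.trans hba) q.2).trans ?_
    calc weightConst N α / (α / 2 + 1) * δ ^ (α / 2 + 1) * ‖absPow hp u' - absPow hp v'‖
        ≤ weightConst N α / (α / 2 + 1) * δ ^ (α / 2 + 1) * (p * B ^ (p - 1) * ‖u' - v'‖) :=
          mul_le_mul_of_nonneg_left (norm_absPow_sub_le hp hu'B hv'B) (by positivity)
      _ = weightConst N α / (α / 2 + 1) * δ ^ (α / 2 + 1) * (p * B ^ (p - 1)) * ‖u' - v'‖ := by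
          ring
      _ ≤ _ := mul_le_mul_of_nonneg_right hδ (norm_nonneg _)
  have h0 : u' - v' = 0 := norm_le_zero_iff.1 (by linarith)
  intro t ht x
  rcases le_total t a with hta | hta
  · exact h t ⟨ht.1, hta⟩ x
  · have h5 : (u' - v') (t - a, x) = 0 := by rw [h0]; rfl
    have h6 : cl (t - a) = t := by
      simp [hcl, hta, ht.2]
    have h7 : (u' - v') (t - a, x) = u (cl (t - a), x) - v (cl (t - a), x) := rfl
    rw [h7, h6] at h5
    linarith

/-- Uniqueness of bounded continuous solutions of the integral equation. -/
lemma SolvesOn.unique (hN : 2 ≤ N) (hα : -2 < α) (hα₀ : α ≤ 0) (hp : 1 < p)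
    {S : ℝ} {u v : ℝ × Space N →ᵇ ℝ} (hu : SolvesOn α p ζ w g S u)
    (hv : SolvesOn α p ζ w g S v) : ∀ t ∈ Icc 0 S, ∀ x, u (t, x) = v (t, x) := by
  intro t ht
  have hS : 0 ≤ S := ht.1.trans ht.2
  set B := max ‖u‖ ‖v‖
  obtain ⟨δ, hδ, -, hsmall⟩ := exists_pos_mul_rpow_mul_le
    (C := weightConst N α / (α / 2 + 1)) (e := α / 2 + 1) (by linarith) (p * B ^ (p - 1))
  -- The norms of u and v are global, so the same step δ serves every window and finitely many cover
  -- [0,S].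
  have hind : ∀ n : ℕ, ∀ s ∈ Icc 0 (min (n * δ) S), ∀ x, u (s, x) = v (s, x) := by
    intro n
    induction n with
    | zero =>
      intro s hs x
      have hs2 := hs.2.trans (min_le_left _ _)
      rw [Nat.cast_zero, zero_mul] at hs2
      rw [le_antisymm hs2 hs.1, hu.apply_zero hS, hv.apply_zero hS]
    | succ n ih =>
      refine SolvesOn.eq_step hN hα hα₀ hp hu hv (le_max_left _ _) (le_max_right _ _) hsmall hδ
        (le_min (by positivity) hS) (min_le_min_right _ ?_) (min_le_right _ _) ?_ ih
      · push_cast; linarith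
      · push_cast
        rcases le_total (n * δ) S with h | h
        · rw [min_eq_left h]; have := min_le_left ((n + 1) * δ) S; linarith
        · rw [min_eq_right h]; have := min_le_right ((n + 1) * δ) S; linarith
  obtain ⟨n, hn⟩ := exists_nat_ge (S / δ)
  refine hind n t ⟨ht.1, le_min (ht.2.trans ?_) ht.2⟩
  exact (div_le_iff₀ hδ).1 hn

lemma exists_bcf_eq {f : Space N → ℝ} (hf : Continuous f) {C : ℝ} (hC : ∀ x, |f x| ≤ C) :
    ∃ φ : Space N →ᵇ ℝ, ⇑φ = f :=
  ⟨BoundedContinuousFunction.ofNormedAddCommGroup f hf C hC, rfl⟩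

/-- Concatenation of a solution on `[0,S]` with one of the problem restarted at time `S`. -/
lemma SolvesOn.glue (hN : 2 ≤ N) (hα : -2 < α) (hα₀ : α ≤ 0) (hp : 1 < p) (hm : Measurable ζ)
    (hζ : ∀ b c, IntervalIntegrable ζ volume b c) {S δ : ℝ} (hS : 0 ≤ S) (hδ : 0 ≤ δ)
    {u v : ℝ × Space N →ᵇ ℝ} (hu : SolvesOn α p ζ w g S u) {g' : Space N →ᵇ ℝ}
    (hg' : ∀ x, g' x = u (S, x)) (hv : SolvesOn α p (fun τ => ζ (S + τ)) w g' δ v) :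
    ∃ U, SolvesOn α p ζ w g (S + δ) U := by
  have hN' : (2 : ℝ) ≤ N := by exact_mod_cast hN
  let k₁ : C(ℝ × Space N, ℝ × Space N) := ⟨fun q => (min q.1 S, q.2), by fun_prop⟩
  let k₂ : C(ℝ × Space N, ℝ × Space N) := ⟨fun q => (max (q.1 - S) 0, q.2), by fun_prop⟩
  let k₃ : C(ℝ × Space N, ℝ × Space N) := ⟨fun q => (S, q.2), by fun_prop⟩
  -- Freezing u after S and v before its start makes the concatenation a sum of continuous
  -- functions; the doubly counted u(S,·) is subtracted.
  set U := u.compContinuous k₁ + v.compContinuous k₂ - u.compContinuous k₃ with hU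
  have hUq : ∀ t x, U (t, x) = u (min t S, x) + v (max (t - S) 0, x) - u (S, x) :=
    fun t x => rfl
  have hU1 : ∀ t, t ≤ S → ∀ x, U (t, x) = u (t, x) := by
    intro t ht x
    rw [hUq, min_eq_left ht, max_eq_right (by linarith), hv.apply_zero hδ, hg']
    ring
  have hU2 : ∀ r, 0 ≤ r → ∀ x, U (S + r, x) = v (r, x) := by
    intro r hr x
    rw [hUq, min_eq_right (by linarith), add_sub_cancel_left S r, max_eq_left hr]
    ring
  have hD1 : ∀ t, 0 ≤ t → t ≤ S → ∀ x, duhamel (weighted α fun τ y => |U (τ, y)| ^ p) t x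
      = duhamel (weighted α fun τ y => |u (τ, y)| ^ p) t x := fun t ht htS x =>
    duhamel_congr ht (fun τ hτ => by
      ext y; simp only [weighted]; rw [hU1 τ (hτ.2.le.trans htS)]) x
  refine ⟨U, fun t ht x => ?_⟩
  rcases le_total t S with htS | htS
  · rw [hU1 t htS, hu t ⟨ht.1, htS⟩, hD1 t ht.1 htS]
  obtain ⟨r, rfl⟩ : ∃ r, t = S + r := ⟨t - S, by ring⟩
  have hr : 0 ≤ r := by linarith
  have hr' : r ≤ δ := by linarith [ht.2]
  have hk : Continuous fun y : Space N => (S, y) := by fun_prop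
  have hk' : ∀ y : Space N, (S, y) ∈ {q : ℝ × Space N | 0 ≤ q.1} := fun _ => hS
  -- The three parts of u(S,·) are bounded and continuous, which allows the semigroup to be
  -- distributed over their sum.
  obtain ⟨a₁, ha₁⟩ : ∃ φ : Space N →ᵇ ℝ, ⇑φ = heatSemigroup S g := exists_bcf_eq
    ((continuousOn_heatSemigroup g).comp_continuous hk hk') (abs_heatSemigroup_le hS g)
  obtain ⟨a₂, ha₂⟩ : ∃ φ : Space N →ᵇ ℝ,
      ⇑φ = duhamel (weighted α fun τ y => |U (τ, y)| ^ p) S := exists_bcf_eq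
    ((continuousOn_duhamel_weighted hN hα hα₀ (absPow hp U)).comp_continuous hk hk')
    (abs_duhamel_weighted_le hN hα hα₀ (absPow hp U) hS)
  obtain ⟨a₃, ha₃⟩ : ∃ φ : Space N →ᵇ ℝ, ⇑φ = duhamel (forcing ζ w) S := exists_bcf_eq
    ((continuousOn_duhamel_forcing hm hζ w).comp_continuous hk hk')
    (abs_duhamel_forcing_le (by omega) hm hζ w hS)
  have hsplit : (g' : Space N → ℝ) = fun y => (a₁ + a₂) y + a₃ y := by
    ext y
    rw [hg', hu S ⟨hS, le_rfl⟩, ← hD1 S hS le_rfl, BoundedContinuousFunction.coe_add,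
      Pi.add_apply, ha₁, ha₂, ha₃]
  have hF1 := (isSource_weighted α (absPow hp U)).duhamel_add (by linarith) hα₀ hS hr
    (fun r _ => intervalIntegrable_const_mul_sub_rpow hα _ _ _ _) x
  have hF2 := (isSource_forcing hm w).duhamel_add (by linarith) le_rfl hS hr
    (fun r _ => intervalIntegrable_forcing hζ _ _ _ _) x
  have hF3 : duhamel (fun τ => weighted α (fun τ y => absPow hp U (τ, y)) (S + τ)) r x
      = duhamel (weighted α fun τ y => |v (τ, y)| ^ p) r x := by
    refine duhamel_congr hr (fun τ hτ => ?_) x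
    ext y
    simp only [weighted, absPow_apply]
    rw [hU2 τ hτ.1.le]
  rw [hU2 r hr, hv r ⟨hr, hr'⟩, hsplit, heatSemigroup_add_bcf hr, BoundedContinuousFunction.coe_add]
  have hadd : heatSemigroup r (⇑a₁ + ⇑a₂) x = heatSemigroup r a₁ x + heatSemigroup r a₂ x :=
    heatSemigroup_add_bcf hr a₁ a₂ x
  rw [hadd, ha₁, ha₂, ha₃]
  rw [hF3] at hF1
  have hF0 := heatSemigroup_heatSemigroup (by omega) hr hS g x
  simp only [absPow_apply] at hF1 ⊢
  rw [hF1, hF2, hF0]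
  ring

/-- Uniform continuation: the extension time depends only on the size of the solution at the
restarting time and on an upper bound for that time. -/
lemma exists_extend (hN : 2 ≤ N) (hα : -2 < α) (hα₀ : α ≤ 0) (hp : 1 < p) (hm : Measurable ζ)
    (hζ : ∀ b c, IntervalIntegrable ζ volume b c) (w g : Space N →ᵇ ℝ) (M R : ℝ) :
    ∃ δ, 0 < δ ∧ ∀ S, 0 ≤ S → S ≤ R → ∀ u, SolvesOn α p ζ w g S u → (∀ x, |u (S, x)| ≤ M) →
      ∃ U, SolvesOn α p ζ w g (S + δ) U := by
  -- For 0 ≤ S ≤ R the window [S, S+1] lies in [0, R+1], which bounds the shifted forcing uniformly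
  -- in S.
  obtain ⟨δ, hδ, h⟩ := exists_solvesOn hN hα hα₀ hp w |M| (∫ τ in (0 : ℝ)..(R + 1), |ζ τ|)
  refine ⟨δ, hδ, fun S hS hSR u hu hM => ?_⟩
  let k : C(Space N, ℝ × Space N) := ⟨fun x => (S, x), by fun_prop⟩
  have hI : ∫ τ in (0 : ℝ)..1, |ζ (S + τ)| ≤ ∫ τ in (0 : ℝ)..(R + 1), |ζ τ| := by
    rw [intervalIntegral.integral_comp_add_left (fun τ => |ζ τ|) S]
    exact intervalIntegral.integral_mono_interval (by linarith) (by linarith) (by linarith)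
      (ae_of_all _ fun τ => abs_nonneg _) (hζ _ _).abs
  obtain ⟨v, hv⟩ := h (fun τ => ζ (S + τ)) (by fun_prop)
    (fun b c => by simpa using (hζ (S + b) (S + c)).comp_add_left S) hI (u.compContinuous k)
    ((BoundedContinuousFunction.norm_le (abs_nonneg _)).2 fun x => (hM x).trans (le_abs_self M))
  exact hu.glue hN hα hα₀ hp hm hζ hS hδ.le (g' := u.compContinuous k) (fun x => rfl) hv

end Solutions

/-! ### Measurability and local integrability of the time factor -/

section Profile

variable {σ : ℝ} {ζ : ℝ → ℝ}

lemma IsForcingProfile.nonneg (hζ : IsForcingProfile σ ζ) {t : ℝ} (ht : 0 < t) : 0 ≤ ζ t := by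
  rcases hζ with h | ⟨m, h₁, h₂⟩
  · rw [h t ht]; positivity
  · rcases lt_or_ge t 1 with h | h
    · rw [h₁ t ht h]; positivity
    · rw [h₂ t h]; positivity

/-- Nothing is prescribed for ζ at t ≤ 0, so it is cut off there. Replacing t by max(t,1) changes
nothing for t ≥ 1 and makes the power continuous on ℝ for every m. -/
lemma IsForcingProfile.indicator_eq (hζ : IsForcingProfile σ ζ) :
    (Ioi 0).indicator ζ = (Ioi 0).indicator (fun t => t ^ σ) ∨ ∃ m : ℝ, (Ioi 0).indicator ζ =
      (Ioo 0 1).indicator (fun t => t ^ σ) + (Ici 1).indicator (fun t => (max t 1) ^ m) := by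
  refine hζ.imp (fun h => ?_) (fun ⟨m, h₁, h₂⟩ => ⟨m, ?_⟩)
  · exact indicator_congr fun t ht => h t ht
  · ext t
    rw [Pi.add_apply]
    rcases le_or_gt t 0 with h0 | h0
    · rw [indicator_of_notMem (by simpa), indicator_of_notMem (fun h => h.1.not_ge h0),
        indicator_of_notMem (by simp; linarith), add_zero]
    rw [indicator_of_mem (by simpa)]
    rcases lt_or_ge t 1 with h1 | h1
    · rw [indicator_of_mem (show t ∈ Ioo 0 1 from ⟨h0, h1⟩),
        indicator_of_notMem (by simpa), add_zero, h₁ t h0 h1]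
    · rw [indicator_of_notMem (fun h => h.2.not_ge h1), indicator_of_mem (by simpa), zero_add,
        max_eq_left h1, h₂ t h1]

lemma IsForcingProfile.measurable_indicator (hζ : IsForcingProfile σ ζ) :
    Measurable ((Ioi 0).indicator ζ) := by
  rcases hζ.indicator_eq with h | ⟨m, h⟩ <;> rw [h]
  · exact Measurable.indicator (by fun_prop) measurableSet_Ioi
  · exact (Measurable.indicator (by fun_prop) measurableSet_Ioo).add
      (Measurable.indicator (by fun_prop) measurableSet_Ici)

lemma intervalIntegrable_set_indicator {f : ℝ → ℝ} {b c : ℝ}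
    (hf : IntervalIntegrable f volume b c) {s : Set ℝ} (hs : MeasurableSet s) :
    IntervalIntegrable (s.indicator f) volume b c :=
  ⟨hf.1.indicator hs, hf.2.indicator hs⟩

lemma IsForcingProfile.intervalIntegrable_indicator (hζ : IsForcingProfile σ ζ) (hσ : -1 < σ)
    (b c : ℝ) : IntervalIntegrable ((Ioi 0).indicator ζ) volume b c := by
  have hpow : IntervalIntegrable (fun t : ℝ => t ^ σ) volume b c :=
    intervalIntegral.intervalIntegrable_rpow' hσ
  rcases hζ.indicator_eq with h | ⟨m, h⟩ <;> rw [h]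
  · exact intervalIntegrable_set_indicator hpow measurableSet_Ioi
  · refine (intervalIntegrable_set_indicator hpow measurableSet_Ioo).add
      (intervalIntegrable_set_indicator ?_ measurableSet_Ici)
    refine Continuous.intervalIntegrable ?_ _ _
    exact (continuous_id.max continuous_const).rpow_const
      fun t => Or.inl (lt_of_lt_of_le one_pos (le_max_right _ _)).ne'

end Profile

/-! ### Passage between mild solutions and the closed-interval problem -/

section Maximal

variable {N : ℕ} {α p σ : ℝ} {ζ : ℝ → ℝ} {w u₀ : Space N →ᵇ ℝ}

lemma forcing_indicator (ζ : ℝ → ℝ) (w : Space N → ℝ) {τ : ℝ} (hτ : 0 < τ) :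
    forcing ((Ioi 0).indicator ζ) w τ = fun y => ζ τ * w y := by
  ext y; simp only [forcing]; rw [indicator_of_mem (by simpa)]

/-- Clamping time to [0,S] turns u, controlled only before T, into a global bounded continuous
function to which the fixed-interval theory applies. -/
lemma IsMildSolution.exists_solvesOn {T : EReal} {u : ℝ → Space N → ℝ}
    (hu : IsMildSolution α p ζ w u₀ T u) {S : ℝ} (hS : 0 ≤ S) (hST : (S : EReal) < T) :
    ∃ U : ℝ × Space N →ᵇ ℝ, SolvesOn α p ((Ioi 0).indicator ζ) w u₀ S U ∧
      ∀ t ∈ Icc 0 S, ∀ x, U (t, x) = u t x := by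
  obtain ⟨M, hM⟩ := hu.bounded S hST
  have hcl : ∀ t, max 0 (min t S) ∈ Icc 0 S := fun t =>
    ⟨le_max_left _ _, max_le hS (min_le_right _ _)⟩
  have hcont : Continuous fun q : ℝ × Space N => u (max 0 (min q.1 S)) q.2 :=
    hu.continuousOn.comp_continuous (f := fun q : ℝ × Space N => (max 0 (min q.1 S), q.2))
      (by fun_prop) fun q =>
        ⟨(hcl q.1).1, (EReal.coe_le_coe_iff.2 (hcl q.1).2).trans_lt hST⟩
  let U : ℝ × Space N →ᵇ ℝ := BoundedContinuousFunction.ofNormedAddCommGroup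
    (fun q => u (max 0 (min q.1 S)) q.2) hcont M fun q => hM _ (hcl q.1) q.2
  have hU : ∀ t ∈ Icc 0 S, ∀ x, U (t, x) = u t x := by
    intro t ht x
    change u (max 0 (min t S)) x = u t x
    rw [min_eq_left ht.2, max_eq_right ht.1]
  refine ⟨U, fun t ht x => ?_, hU⟩
  rw [hU t ht, hu.integral_eq t ht.1 ((EReal.coe_le_coe_iff.2 ht.2).trans_lt hST) x]
  congr 1
  · congr 1
    refine duhamel_congr ht.1 (fun τ hτ => ?_) x
    ext y
    simp only [weighted]
    rw [hU τ ⟨hτ.1.le, hτ.2.le.trans ht.2⟩]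
  · exact duhamel_congr ht.1 (fun τ hτ => (forcing_indicator ζ w hτ.1).symm) x

lemma SolvesOn.isMildSolution (hN : 2 ≤ N) (hα : -2 < α) (hα₀ : α ≤ 0) (hp : 1 < p)
    (hσ : -1 < σ) (hζ : IsForcingProfile σ ζ) {S : ℝ} (hS : 0 < S) {U : ℝ × Space N →ᵇ ℝ}
    (hU : SolvesOn α p ((Ioi 0).indicator ζ) w u₀ S U) :
    IsMildSolution α p ζ w u₀ (S : EReal) (fun t x => U (t, x)) where
  pos := by exact_mod_cast hS
  continuousOn := U.continuous.continuousOn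
  bounded _ _ := ⟨‖U‖, fun t _ x => U.norm_coe_le_norm (t, x)⟩
  converges t ht _ x := by
    have hN' : (2 : ℝ) ≤ N := by exact_mod_cast hN
    constructor
    · exact (isSource_weighted α (absPow hp U)).converges (by linarith) hα₀ ht
        (intervalIntegrable_const_mul_sub_rpow hα _ _ _ _) x
    · exact ((isSource_forcing hζ.measurable_indicator w).converges (by linarith) le_rfl ht
        (intervalIntegrable_forcing (hζ.intervalIntegrable_indicator hσ) _ _ _ _) x).congr ht
          fun τ hτ => forcing_indicator ζ w hτ.1
  integral_eq t ht htS x := by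
    rw [hU t ⟨ht, (EReal.coe_lt_coe_iff.1 htS).le⟩ x]
    congr 1
    exact duhamel_congr ht (fun τ hτ => forcing_indicator ζ w hτ.1) x

lemma IsMildSolution.unique (hN : 2 ≤ N) (hα : -2 < α) (hα₀ : α ≤ 0) (hp : 1 < p)
    {T₁ T₂ : EReal} {u v : ℝ → Space N → ℝ} (hu : IsMildSolution α p ζ w u₀ T₁ u)
    (hv : IsMildSolution α p ζ w u₀ T₂ v) {t : ℝ} (ht : 0 ≤ t) (h₁ : (t : EReal) < T₁)
    (h₂ : (t : EReal) < T₂) : u t = v t := by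
  obtain ⟨U, hU, hUu⟩ := hu.exists_solvesOn ht h₁
  obtain ⟨V, hV, hVv⟩ := hv.exists_solvesOn ht h₂
  ext x
  rw [← hUu t ⟨ht, le_rfl⟩ x, ← hVv t ⟨ht, le_rfl⟩ x]
  exact hU.unique hN hα hα₀ hp hV t ⟨ht, le_rfl⟩ x

/-- No comparison principle is needed: the source |x|^α|u|^p is nonnegative whatever the sign of u.
-/
lemma IsMildSolution.nonneg (hζ : IsForcingProfile σ ζ) {T : EReal} {u : ℝ → Space N → ℝ}
    (hu : IsMildSolution α p ζ w u₀ T u) (hu₀ : ∀ x, 0 ≤ u₀ x) (hw : ∀ x, 0 ≤ w x) {t : ℝ}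
    (ht : 0 ≤ t) (htT : (t : EReal) < T) (x : Space N) : 0 ≤ u t x := by
  rw [hu.integral_eq t ht htT x]
  refine add_nonneg (add_nonneg (heatSemigroup_nonneg ht hu₀ x) ?_) ?_
  · exact duhamel_nonneg ht (fun τ _ y => by positivity) x
  · exact duhamel_nonneg ht (fun τ hτ y => mul_nonneg (hζ.nonneg hτ) (hw y)) x

/-- A time-dependent function that locally in time coincides with mild solutions is one. -/
lemma isMildSolution_of_forall_lt {T : EReal} (hT : 0 < T) {u : ℝ → Space N → ℝ}
    (h : ∀ t : ℝ, (t : EReal) < T → ∃ T' v, (t : EReal) < T' ∧ IsMildSolution α p ζ w u₀ T' v ∧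
      ∀ s : ℝ, 0 ≤ s → (s : EReal) < T' → u s = v s) :
    IsMildSolution α p ζ w u₀ T u where
  pos := hT
  continuousOn q hq := by
    obtain ⟨T', v, htT', hv, huv⟩ := h q.1 hq.2
    have h1 := (hv.continuousOn q ⟨hq.1, htT'⟩).congr
      (g := fun q : ℝ × Space N => u q.1 q.2) (fun r hr => by rw [huv r.1 hr.1 hr.2])
      (by rw [huv q.1 hq.1 htT'])
    refine h1.mono_of_mem_nhdsWithin ?_
    have h2 : ∀ᶠ r : ℝ × Space N in 𝓝 q, (r.1 : EReal) < T' :=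
      (continuous_coe_real_ereal.comp continuous_fst).continuousAt.eventually (gt_mem_nhds htT')
    filter_upwards [mem_nhdsWithin_of_mem_nhds h2, self_mem_nhdsWithin] with r h3 h4
    exact ⟨h4.1, h3⟩
  bounded S hS := by
    obtain ⟨T', v, hST', hv, huv⟩ := h S hS
    obtain ⟨M, hM⟩ := hv.bounded S hST'
    refine ⟨M, fun t ht x => ?_⟩
    rw [huv t ht.1 ((EReal.coe_le_coe_iff.2 ht.2).trans_lt hST')]
    exact hM t ht x
  converges t ht htT x := by
    obtain ⟨T', v, htT', hv, huv⟩ := h t htT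
    refine ⟨(hv.converges t ht htT' x).1.congr ht fun τ hτ => ?_, (hv.converges t ht htT' x).2⟩
    rw [huv τ hτ.1.le ((EReal.coe_lt_coe_iff.2 hτ.2).trans htT')]
  integral_eq t ht htT x := by
    obtain ⟨T', v, htT', hv, huv⟩ := h t htT
    rw [huv t ht htT', hv.integral_eq t ht htT' x]
    congr 2
    refine duhamel_congr ht (fun τ hτ => ?_) x
    rw [huv τ hτ.1.le ((EReal.coe_lt_coe_iff.2 hτ.2).trans htT')]

/-- An essential bound holds on a set of full measure, which is dense; continuity extends it to
every point. -/
lemma abs_le_of_eLpNorm_top_le {f : Space N → ℝ} (hf : Continuous f) {M : NNReal}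
    (hM : eLpNorm f ⊤ volume ≤ M) (x : Space N) : |f x| ≤ M := by
  have hae : ∀ᵐ y, |f y| ≤ M := by
    filter_upwards [enorm_ae_le_eLpNormEssSup f volume] with y hy
    rw [eLpNorm_exponent_top] at hM
    have := hy.trans hM
    rw [← Real.norm_eq_abs, ← coe_nnnorm]
    exact_mod_cast this
  have hd : Dense {y | |f y| ≤ M} := Measure.dense_of_ae hae
  have hc : IsClosed {y | |f y| ≤ M} := isClosed_le hf.abs continuous_const
  have : x ∈ closure {y | |f y| ≤ M} := hd x
  rwa [hc.closure_eq] at this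

end Maximal

end InhomogeneousHeat

/-! ### The maximal solution and its blow-up -/

open InhomogeneousHeat in
theorem theorem1p1 (N : ℕ) (hN : 3 ≤ N) (α p σ : ℝ) (hα : -2 < α) (hα₀ : α ≤ 0)
    (hp : 1 < p) (hσ : -1 < σ) (ζ : ℝ → ℝ) (hζ : InhomogeneousHeat.IsForcingProfile σ ζ)
    (w u₀ : EuclideanSpace ℝ (Fin N) →ᵇ ℝ) :
    ∃ (T : EReal) (u : ℝ → EuclideanSpace ℝ (Fin N) → ℝ),
      InhomogeneousHeat.IsMaximalMildSolution α p ζ w u₀ T u ∧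
      -- uniqueness: every mild solution is a restriction of `u`
      (∀ (T' : EReal) (v : ℝ → EuclideanSpace ℝ (Fin N) → ℝ),
        InhomogeneousHeat.IsMildSolution α p ζ w u₀ T' v →
          T' ≤ T ∧ ∀ t : ℝ, 0 ≤ t → (t : EReal) < T' → v t = u t) ∧
      -- blow-up of the sup norm at a finite maximal time
      (∀ T₀ : ℝ, T = (T₀ : EReal) →
        Tendsto (fun t : ℝ => eLpNorm (u t) ⊤ volume) (𝓝[<] T₀) (𝓝 ⊤)) ∧
      -- nonnegativity
      ((∀ x, 0 ≤ u₀ x) → (∀ x, 0 ≤ w x) →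
        ∀ t : ℝ, 0 ≤ t → (t : EReal) < T → ∀ x, 0 ≤ u t x) := by
  have hN2 : 2 ≤ N := by omega
  have hm := hζ.measurable_indicator
  have hi := hζ.intervalIntegrable_indicator hσ
  classical
  set T : EReal := sSup {T' | ∃ v, IsMildSolution α p ζ w u₀ T' v} with hT
  have hle : ∀ T' v, IsMildSolution α p ζ w u₀ T' v → T' ≤ T := fun T' v hv => le_sSup ⟨v, hv⟩
  have hlt : ∀ t : ℝ, (t : EReal) < T →
      ∃ T' v, (t : EReal) < T' ∧ IsMildSolution α p ζ w u₀ T' v := by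
    intro t ht
    obtain ⟨T', ⟨v, hv⟩, h⟩ := lt_sSup_iff.1 ht
    exact ⟨T', v, h, hv⟩
  -- By uniqueness all solutions alive at time t share one value. From T on no solution exists, and
  -- 0 is an arbitrary choice.
  have hlt' : ∀ t : ℝ, ∃ f : Space N → ℝ, ∀ T' v, 0 ≤ t → (t : EReal) < T' →
      IsMildSolution α p ζ w u₀ T' v → v t = f := by
    intro t
    by_cases ht : (t : EReal) < T
    · obtain ⟨T', v, h, hv⟩ := hlt t ht
      exact ⟨v t, fun T'' v' h0 h' hv' => hv'.unique hN2 hα hα₀ hp hv h0 h' h⟩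
    · exact ⟨0, fun T' v _ h hv => absurd (h.trans_le (hle T' v hv)) ht⟩
  choose u hu using hlt'
  have hTpos : 0 < T := by
    -- Local existence is continuation of the trivial solution on the degenerate interval [0,0].
    obtain ⟨δ, hδ, h⟩ := exists_extend hN2 hα hα₀ hp hm hi w u₀ ‖u₀‖ 0
    let U₀ : ℝ × Space N →ᵇ ℝ := u₀.compContinuous ⟨Prod.snd, continuous_snd⟩
    have hU₀ : SolvesOn α p ((Ioi 0).indicator ζ) w u₀ 0 U₀ := by
      intro t ht x
      obtain rfl : t = 0 := le_antisymm ht.2 ht.1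
      simp [heatSemigroup, duhamel, U₀]
    obtain ⟨U, hU⟩ := h 0 le_rfl le_rfl U₀ hU₀ fun x => u₀.norm_coe_le_norm x
    rw [zero_add] at hU
    have := hU.isMildSolution hN2 hα hα₀ hp hσ hζ hδ
    exact this.pos.trans_le (hle _ _ this)
  have hmild : IsMildSolution α p ζ w u₀ T u := by
    refine isMildSolution_of_forall_lt hTpos fun t ht => ?_
    obtain ⟨T', v, h, hv⟩ := hlt t ht
    exact ⟨T', v, h, hv, fun s hs hsT => (hu s T' v hs hsT hv).symm⟩
  refine ⟨T, u, ⟨hmild, fun T' v hT' hv => absurd (hle T' v hv) hT'.not_ge⟩,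
    fun T' v hv => ⟨hle T' v hv, fun t ht htT => hu t T' v ht htT hv⟩, fun T₀ hT₀ => ?_,
    fun hu₀ hw t ht htT x => hmild.nonneg hζ hu₀ hw ht htT x⟩
  have hT₀pos : 0 < T₀ := by rw [hT₀] at hTpos; exact_mod_cast hTpos
  rw [ENNReal.tendsto_nhds_top_iff_nnreal]
  intro M
  by_contra hcon
  -- This δ is fixed before the restarting time t is chosen, so t can be taken in (T₀ - δ, T₀) with
  -- sup norm at most M; the extension then outlives the supremum T₀.
  obtain ⟨δ, hδ, hext⟩ := exists_extend hN2 hα hα₀ hp hm hi w u₀ M T₀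
  have hfreq : ∃ᶠ t in 𝓝[<] T₀, ¬ (M : ENNReal) < eLpNorm (u t) ⊤ volume :=
    not_eventually.1 hcon
  have hev : ∀ᶠ t in 𝓝[<] T₀, t ∈ Ioo (max 0 (T₀ - δ)) T₀ :=
    Ioo_mem_nhdsLT (max_lt hT₀pos (by linarith))
  obtain ⟨t, htM, ht1, ht2⟩ := (hfreq.and_eventually hev).exists
  have ht0 : 0 ≤ t := (le_max_left _ _).trans ht1.le
  have htδ : T₀ < t + δ := by have := (le_max_right 0 (T₀ - δ)).trans_lt ht1; linarith
  have htT : (t : EReal) < T := by rw [hT₀]; exact_mod_cast ht2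
  have hcont : Continuous (u t) :=
    hmild.continuousOn.comp_continuous (f := fun x : Space N => (t, x)) (by fun_prop)
      fun x => ⟨ht0, htT⟩
  obtain ⟨U, hU, hUu⟩ := hmild.exists_solvesOn ht0 htT
  obtain ⟨V, hV⟩ := hext t ht0 ht2.le U hU fun x => by
    rw [hUu t ⟨ht0, le_rfl⟩ x]
    exact abs_le_of_eLpNorm_top_le hcont (not_lt.1 htM) x
  have := hle _ _ (hV.isMildSolution hN2 hα hα₀ hp hσ hζ (by linarith))
  rw [hT₀] at this
  exact htδ.not_ge (EReal.coe_le_coe_iff.1 this)
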